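/- Let $b^-\ge 2$ and $b^+$ be natural numbers, let $\ell^\pm,q^\pm$ be real numbers with $\ell^->0$, put $\mathcal A=\{b^-,\dots,b^+\}\times[\ell^-,\ell^+]\times[q^-,q^+]$, let $\widetilde\mu$ be a Borel probability measure on $\mathcal A$, and let $(\Omega,\mu)=(\mathcal A^{\mathbb N},\widetilde\mu^{\mathbb N})$, $\mathbb N=\{1,2,\dots\}$. For a sequence $(b,\ell,q)=(b_n,\ell_n,q_n)_{n\ge1}\in\mathcal A^{\mathbb N}$ let $\Gamma_{b,\ell}$ be the rooted radial metric tree whose root $o$ has exactly one child, in which every vertex of generation $n\ge1$ has $b_n$ children, and in which every edge joining generation $n-1$ to generation $n$ has length $\ell_n$. Let $\mathbb H(b,\ell,q)$ be the operator $-\frac{d^2}{dx^2}$ in $L^2(\Gamma_{b,\ell})=\bigoplus_e L^2(e)$ (the sum is over all edges $e$) whose domain is the set of all $f\in\bigoplus_e H^2(e)$ such that $f(o)=0$, $f$ is continuous at every vertex, and $\sum_{e\ni v}\partial^e_\nu f(v)=q_n f(v)$ for every vertex $v$ of generation $n\ge1$, where $\partial_\nu^e f(v)$ is the derivative of $f$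 at $v$ along $e$ in the direction from $v$ into $e$. For $\omega\in\Omega$, $\omega(n)=(b_\omega(n),\ell_\omega(n),q_\omega(n))$, put $\mathbb H_\omega=\mathbb H(b_\omega,\ell_\omega,q_\omega)$. Then there is a set $\widehat\Omega\subset\Omega$ of full $\mu$-measure such that for all $\omega\in\widehat\Omega$ $$\sigma(\mathbb H_\omega)=\Sigma:=\overline{\bigcup_{(b,\ell,q)}\sigma(\mathbb H(b,\ell,q))},$$ where the union is over all periodic sequences $(b,\ell,q)=(b_n,\ell_n,q_n)_{n\ge1}$ (that is, for some $N\ge1$, $(b_{n+N},\ell_{n+N},q_{n+N})=(b_n,\ell_n,q_n)$ for all $n\ge 1$) with $(b_n,\ell_n,q_n)\in\operatorname{supp}\widetilde\mu$ for all $n$. -/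

import Mathlib

open MeasureTheory Set
noncomputable section

/-! ### Radial trees

Parameters of a radial tree are sequences `b : ℕ → ℕ`, `ℓ : ℕ → ℝ`, `q : ℕ → ℝ`, where the entry of
index `n` belongs to generation `n + 1`: `b n` and `q n` are the branching number and the coupling
constant of the vertices of generation `n + 1`, and `ℓ n` is the length of the edges of
generation `n + 1` (those joining generation `n` to generation `n + 1`). -/

/-- Number of children of a vertex of given generation; the root (generation `0`) has one child. -/
def branching (b : ℕ → ℕ) : ℕ → ℕ
  | 0 => 1
  | n + 1 => b n

/-- Vertices of generation `n` of the radial tree with branching sequence `b`: the root, or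
a vertex of the previous generation together with the number of one of its children. -/
def TreeVertex (b : ℕ → ℕ) : ℕ → Type
  | 0 => Unit
  | n + 1 => TreeVertex b n × Fin (branching b n)

/-- The `j`-th child of a vertex. -/
def TreeVertex.child {b : ℕ → ℕ} {n : ℕ} (v : TreeVertex b n) (j : Fin (branching b n)) :
    TreeVertex b (n + 1) :=
  (v, j)

/-- Edges. Each edge is labelled by its endpoint farther from the root: `⟨n, v⟩`, with `v` a vertex
of generation `n + 1`, is the edge of generation `n + 1` from the parent of `v` to `v`. -/
abbrev TreeEdge (b : ℕ → ℕ) : Type := Σ n : ℕ, TreeVertex b (n + 1)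

/-- `L²(0, L)`. An edge of length `L` is parametrized by the distance `x ∈ (0, L)` to its endpoint
nearer to the root. -/
abbrev L2Interval (L : ℝ) : Type := Lp ℂ 2 (volume.restrict (Ioo (0 : ℝ) L))

/-- `L²(Γ)`, the Hilbert sum over the edges `e` of the spaces `L²(e)`. -/
abbrev L2Tree (b : ℕ → ℕ) (ℓ : ℕ → ℝ) : Type :=
  lp (fun e : TreeEdge b => L2Interval (ℓ e.1)) 2

/-! ### The operator -/

section Operator

open scoped ContDiff

/-- `g ∈ L²(0, L)` is the weak derivative of `f ∈ L²(0, L)` on `(0, L)`. -/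
def HasWeakDeriv {L : ℝ} (f g : L2Interval L) : Prop :=
  ∀ φ : ℝ → ℝ, ContDiff ℝ ∞ φ → HasCompactSupport φ → tsupport φ ⊆ Ioo 0 L →
    ∫ x in Ioo 0 L, deriv φ x • f x = - ∫ x in Ioo 0 L, φ x • g x

/-- `u` is continuous on `[0, L]` and represents `f ∈ L²(0, L)`. Such a `u` exists for every
`f ∈ H¹(0, L)`, and its values on `[0, L]` are unique if `0 < L`; `u 0` and `u L` are the one-sided
boundary values of `f`. -/
def IsContinuousRep {L : ℝ} (f : L2Interval L) (u : ℝ → ℂ) : Prop :=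
  ContinuousOn u (Icc 0 L) ∧ f =ᵐ[volume.restrict (Ioo (0 : ℝ) L)] u

/-- The vertex conditions for a function with continuous representatives `u e` on the edges `e`
and continuous representatives `u' e` of its derivative. -/
structure VertexConditions (b : ℕ → ℕ) (ℓ q : ℕ → ℝ) (u u' : TreeEdge b → ℝ → ℂ) : Prop where
  /-- Dirichlet condition at the root. -/
  dirichlet : ∀ v : TreeVertex b 1, u ⟨0, v⟩ 0 = 0
  /-- Continuity at each vertex `v` other than the root. -/
  continuity : ∀ (n : ℕ) (v : TreeVertex b (n + 1)) (j : Fin (branching b (n + 1))),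
    u ⟨n + 1, v.child j⟩ 0 = u ⟨n, v⟩ (ℓ n)
  /-- Kirchhoff condition at each vertex `v` other than the root: the sum of the derivatives at `v`
  along the adjacent edges, directed from `v` into the edge, is `q(v)` times the value at `v`. -/
  kirchhoff : ∀ (n : ℕ) (v : TreeVertex b (n + 1)),
    (∑ j : Fin (branching b (n + 1)), u' ⟨n + 1, v.child j⟩ 0) - u' ⟨n, v⟩ (ℓ n)
      = (q n : ℂ) * u ⟨n, v⟩ (ℓ n)

/-- `f` is in the domain of `ℍ(b, ℓ, q)` and `h = ℍ(b, ℓ, q) f = -f''`: on each edge `f` is in `H²`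
with weak derivatives `f'` and `f'' = -h`, the functions `f'` and `f''` are in `L²(Γ)` (so that
the sum of the squares of the `H²` norms over the edges is finite), and the vertex conditions
hold. -/
def IsTreeLaplacian (b : ℕ → ℕ) (ℓ q : ℕ → ℝ) (f h : L2Tree b ℓ) : Prop :=
  ∃ (f' : L2Tree b ℓ) (u u' : TreeEdge b → ℝ → ℂ),
    (∀ e, HasWeakDeriv (f e) (f' e)) ∧ (∀ e, HasWeakDeriv (f' e) (-h e)) ∧
    (∀ e, IsContinuousRep (f e) (u e)) ∧ (∀ e, IsContinuousRep (f' e) (u' e)) ∧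
    VertexConditions b ℓ q u u'

theorem L2Interval.integrable_smul {L : ℝ} (f : L2Interval L) {φ : ℝ → ℝ} (hφ : Continuous φ)
    (hc : HasCompactSupport φ) : Integrable (fun x => φ x • f x) (volume.restrict (Ioo 0 L)) := by
  have h1 : MemLp φ 2 (volume.restrict (Ioo 0 L)) := hφ.memLp_of_hasCompactSupport hc
  have h2 : MemLp (fun x => φ x • f x) 1 (volume.restrict (Ioo 0 L)) :=
    (Lp.memLp f).smul (p := 2) (q := 2) (r := 1) h1
  exact memLp_one_iff_integrable.mp h2

theorem HasWeakDeriv.add {L : ℝ} {f g f₁ g₁ : L2Interval L} (hf : HasWeakDeriv f f₁)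
    (hg : HasWeakDeriv g g₁) : HasWeakDeriv (f + g) (f₁ + g₁) := by
  intro φ h1 h2 h3
  have d1 : Continuous (deriv φ) := h1.continuous_deriv (by simp)
  have e1 : ∫ x in Ioo 0 L, deriv φ x • (f + g : L2Interval L) x
      = (∫ x in Ioo 0 L, deriv φ x • f x) + ∫ x in Ioo 0 L, deriv φ x • g x := by
    rw [← integral_add (f.integrable_smul d1 h2.deriv) (g.integrable_smul d1 h2.deriv)]
    refine integral_congr_ae ?_
    filter_upwards [Lp.coeFn_add f g] with x hx
    rw [hx]
    simp
  have e2 : ∫ x in Ioo 0 L, φ x • (f₁ + g₁ : L2Interval L) x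
      = (∫ x in Ioo 0 L, φ x • f₁ x) + ∫ x in Ioo 0 L, φ x • g₁ x := by
    rw [← integral_add (f₁.integrable_smul h1.continuous h2)
      (g₁.integrable_smul h1.continuous h2)]
    refine integral_congr_ae ?_
    filter_upwards [Lp.coeFn_add f₁ g₁] with x hx
    rw [hx]
    simp
  rw [e1, e2, hf φ h1 h2 h3, hg φ h1 h2 h3]
  ring

theorem HasWeakDeriv.smul {L : ℝ} {f f₁ : L2Interval L} (c : ℂ) (hf : HasWeakDeriv f f₁) :
    HasWeakDeriv (c • f) (c • f₁) := by
  intro φ h1 h2 h3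
  have key : ∀ (ψ : ℝ → ℝ) (g : L2Interval L),
      ∫ x in Ioo 0 L, ψ x • (c • g : L2Interval L) x = c * ∫ x in Ioo 0 L, ψ x • g x := by
    intro ψ g
    rw [← integral_const_mul]
    refine integral_congr_ae ?_
    filter_upwards [Lp.coeFn_smul c g] with x hx
    simp [hx]
    ring
  rw [key, key, hf φ h1 h2 h3]
  ring

theorem HasWeakDeriv.eq_zero {L : ℝ} {g : L2Interval L} (h : HasWeakDeriv 0 g) : g = 0 := by
  have hz : ∀ᵐ x ∂(volume : Measure ℝ), x ∈ Ioo 0 L → g x = 0 := by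
    refine isOpen_Ioo.ae_eq_zero_of_integral_contDiff_smul_eq_zero ?_ ?_
    · have : IntegrableOn g (Ioo 0 L) volume := (Lp.memLp g).integrable (by norm_num)
      exact this.locallyIntegrableOn
    · intro φ h1 h2 h3
      have h4 := h φ h1 h2 h3
      have h5 : ∫ x in Ioo 0 L, deriv φ x • (0 : L2Interval L) x = 0 := by
        refine integral_eq_zero_of_ae ?_
        filter_upwards [Lp.coeFn_zero ℂ 2 (volume.restrict (Ioo (0 : ℝ) L))] with x hx
        rw [hx]
        simp
      rw [h5, eq_comm, neg_eq_zero] at h4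
      rw [← h4]
      refine (setIntegral_eq_integral_of_forall_compl_eq_zero fun x hx => ?_).symm
      rw [image_eq_zero_of_notMem_tsupport fun h' => hx (h3 h'), zero_smul]
  refine Lp.ext ?_
  filter_upwards [(ae_restrict_iff' measurableSet_Ioo).mpr hz,
    Lp.coeFn_zero ℂ 2 (volume.restrict (Ioo (0 : ℝ) L))] with x h1 h2
  rw [h1, h2]
  rfl

theorem IsContinuousRep.add {L : ℝ} {f g : L2Interval L} {u v : ℝ → ℂ} (hf : IsContinuousRep f u)
    (hg : IsContinuousRep g v) : IsContinuousRep (f + g) (u + v) :=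
  ⟨hf.1.add hg.1, (Lp.coeFn_add f g).trans (hf.2.add hg.2)⟩

theorem IsContinuousRep.smul {L : ℝ} {f : L2Interval L} {u : ℝ → ℂ} (c : ℂ)
    (hf : IsContinuousRep f u) : IsContinuousRep (c • f) (c • u) :=
  ⟨hf.1.const_smul c, (Lp.coeFn_smul c f).trans (hf.2.const_smul c)⟩

/-- The graph of `ℍ(b, ℓ, q)`, a subspace of `L²(Γ) × L²(Γ)`. -/
def treeLaplacianGraph (b : ℕ → ℕ) (ℓ q : ℕ → ℝ) : Submodule ℂ (L2Tree b ℓ × L2Tree b ℓ) where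
  carrier := {p | IsTreeLaplacian b ℓ q p.1 p.2}
  zero_mem' := by
    have w : ∀ e : TreeEdge b, HasWeakDeriv (0 : L2Interval (ℓ e.1)) 0 := by
      intro e φ _ _ _
      have key : ∀ ψ : ℝ → ℝ,
          ∫ x in Ioo 0 (ℓ e.1), ψ x • (0 : L2Interval (ℓ e.1)) x = 0 := by
        intro ψ
        refine integral_eq_zero_of_ae ?_
        filter_upwards [Lp.coeFn_zero ℂ 2 (volume.restrict (Ioo (0 : ℝ) (ℓ e.1)))] with x hx
        rw [hx]
        simp
      rw [key, key, neg_zero]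
    have r : ∀ e : TreeEdge b, IsContinuousRep (0 : L2Interval (ℓ e.1)) 0 :=
      fun e => ⟨continuousOn_const, Lp.coeFn_zero _ _ _⟩
    refine ⟨0, 0, 0, fun e => w e, fun e => ?_, fun e => r e, fun e => r e, ?_, ?_, ?_⟩
    · simpa using w e
    all_goals intros; simp
  add_mem' := by
    rintro ⟨f, h⟩ ⟨g, k⟩ ⟨f', u, u', a1, a2, a3, a4, a5⟩ ⟨g', v, v', c1, c2, c3, c4, c5⟩
    refine ⟨f' + g', u + v, u' + v', fun e => (a1 e).add (c1 e), fun e => ?_,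
      fun e => (a3 e).add (c3 e), fun e => (a4 e).add (c4 e), ?_, ?_, ?_⟩
    · have := (a2 e).add (c2 e)
      rw [← neg_add] at this
      exact this
    · intro x
      simp [a5.dirichlet, c5.dirichlet]
    · intro n x j
      simp [a5.continuity, c5.continuity]
    · intro n x
      have h1 := a5.kirchhoff n x
      have h2 := c5.kirchhoff n x
      simp only [Pi.add_apply, Finset.sum_add_distrib]
      linear_combination h1 + h2
  smul_mem' := by
    rintro c ⟨f, h⟩ ⟨f', u, u', a1, a2, a3, a4, a5⟩
    refine ⟨c • f', c • u, c • u', fun e => (a1 e).smul c, fun e => ?_,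
      fun e => (a3 e).smul c, fun e => (a4 e).smul c, ?_, ?_, ?_⟩
    · have := (a2 e).smul c
      rw [smul_neg] at this
      exact this
    · intro x
      simp [a5.dirichlet]
    · intro n x j
      simp [a5.continuity]
    · intro n x
      have h1 := a5.kirchhoff n x
      simp only [Pi.smul_apply, smul_eq_mul, ← Finset.mul_sum]
      linear_combination c * h1

/-- `ℍ(b, ℓ, q)` is well defined: `f` determines `-f''`. -/
theorem treeLaplacianGraph_singleValued (b : ℕ → ℕ) (ℓ q : ℕ → ℝ) (p : L2Tree b ℓ × L2Tree b ℓ)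
    (hp : p ∈ treeLaplacianGraph b ℓ q) (h0 : p.1 = 0) : p.2 = 0 := by
  obtain ⟨f', u, u', a1, a2, -, -, -⟩ := hp
  ext1
  funext e
  have h1 := a1 e
  rw [h0] at h1
  have h2 : f' e = 0 := HasWeakDeriv.eq_zero h1
  have h3 := a2 e
  rw [h2] at h3
  have h4 := HasWeakDeriv.eq_zero h3
  simpa using h4

/-- The operator `ℍ(b, ℓ, q) = -d²/dx²` in `L²(Γ)`, as an unbounded operator. -/
def treeLaplacian (b : ℕ → ℕ) (ℓ q : ℕ → ℝ) : L2Tree b ℓ →ₗ.[ℂ] L2Tree b ℓ :=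
  (treeLaplacianGraph b ℓ q).toLinearPMap

/-- The defining property of `ℍ(b, ℓ, q)`. -/
theorem treeLaplacian_graph (b : ℕ → ℕ) (ℓ q : ℕ → ℝ) (f h : L2Tree b ℓ) :
    (f, h) ∈ (treeLaplacian b ℓ q).graph ↔ IsTreeLaplacian b ℓ q f h := by
  rw [treeLaplacian, Submodule.toLinearPMap_graph_eq _ (treeLaplacianGraph_singleValued b ℓ q)]
  rfl

/-- The spectrum of an unbounded operator `T`: the set of the `z ∈ ℂ` for which `T - z` does not
have an everywhere defined bounded inverse `R`. -/
def unboundedSpectrum {H : Type*} [NormedAddCommGroup H] [NormedSpace ℂ H] (T : H →ₗ.[ℂ] H) :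
    Set ℂ :=
  {z | ¬ ∃ R : H →L[ℂ] H,
    (∀ g : H, ∃ hg : R g ∈ T.domain, T ⟨R g, hg⟩ - z • R g = g) ∧
    (∀ f : T.domain, R (T f - z • (f : H)) = f)}

end Operator

/-! ### The random model -/

/-- The set `{bmin, …, bmax} × [lmin, lmax] × [qmin, qmax]` of admissible values of
(branching number, edge length, coupling constant) in one generation. -/
def paramSet (bmin bmax : ℕ) (lmin lmax qmin qmax : ℝ) : Set (ℕ × ℝ × ℝ) :=
  Icc bmin bmax ×ˢ Icc lmin lmax ×ˢ Icc qmin qmax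

/-- The spectrum of `ℍ(b, ℓ, q)` for the sequence `ω = (b, ℓ, q)` of parameters. -/
def treeSpectrum {S : Set (ℕ × ℝ × ℝ)} (ω : ℕ → S) : Set ℂ :=
  unboundedSpectrum (treeLaplacian (fun n => (ω n).1.1) (fun n => (ω n).1.2.1)
    (fun n => (ω n).1.2.2))

/-- The set `Σ`: the closure of the union of the spectra of `ℍ(b, ℓ, q)` over all periodic
sequences `(b, ℓ, q)` with values in the support of the single-generation distribution `ν`. -/
def periodicSpectrum {S : Set (ℕ × ℝ × ℝ)} (ν : Measure S) : Set ℂ :=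
  closure (⋃ p ∈ {p : ℕ → S | (∀ n, p n ∈ ν.support) ∧ ∃ N, 0 < N ∧ Function.Periodic p N},
    treeSpectrum p)

end

/-! The spectrum is governed by local data. If a real `z` admits some `f` in the domain with ‖(ℍ -
z) f‖ < ε ‖f‖, then the spectrum of the self-adjoint operator ℍ meets the ε-neighbourhood of `z`;
conversely, a point of the spectrum admits such an `f` for every ε, even inside a core. Here the
core `polyCore` consists of piecewise polynomials living on finitely many generations, so that
`IsApproxEigenvalue` sees only finitely many parameters. Three facts about this property carry the
proof.

Openness (`isOpen_isApproxEigenvalue`): near a given parameter sequence the relevant branching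
numbers do not change, and small changes of the lengths and couplings are absorbed by adding cubics
that repair the vertex conditions and affect the norms continuously.

Transplantation (`IsApproxEigenvalue.of_shift`): an approximate eigenfunction for the shifted
parameters vanishes at its root. Placed with opposite signs on two subtrees hanging from the vertex
of generation one, and extended by zero, it satisfies the vertex conditions of the whole tree. This
is where at least two children are needed.

Recurrence (`ae_forall_isOpen_exists_shift_mem`): almost surely the shifts of `ω` visit every open
set that contains a sequence with values in the support of `ν`, because disjoint blocks of
coordinates are independent.

Almost surely all values of `ω` lie in the support. A point of its spectrum is then an approximate
eigenvalue for `ω`, by openness also for the periodization of a long initial segment, and hence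
close to Σ. Conversely, a point of the spectrum of a periodic sequence is an approximate eigenvalue
for some shift of `ω` by recurrence, then for `ω` itself by transplantation; since the spectrum is
closed, it contains Σ.

The spectral criterion requires that ℍ be the adjoint of its restriction to the core
(`exists_isSemiboundedCore`). Green's formula and a trace inequality uniform over the edges give
symmetry and a lower bound; testing against core functions supported on one edge or around one
vertex recovers the H² regularity and the vertex conditions. -/

noncomputable section

/-! ### Semibounded self-adjoint operators with a core -/

section SelfAdjoint

variable {H : Type*} [NormedAddCommGroup H] [InnerProductSpace ℂ H]
  {M : Type*} [AddCommGroup M] [Module ℂ M]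

open scoped InnerProductSpace

/-- `T` is symmetric and bounded below by `1 - c`, and the operator `A φ ↦ B φ` is a restriction
of `T` whose adjoint is a restriction of `T`. -/
structure IsSemiboundedCore (T : H →ₗ.[ℂ] H) (A B : M →ₗ[ℂ] H) (c : ℝ) : Prop where
  mem : ∀ φ, (A φ, B φ) ∈ T.graph
  symm : ∀ p ∈ T.graph, ∀ p' ∈ T.graph, ⟪p.2, p'.1⟫_ℂ = ⟪p.1, p'.2⟫_ℂ
  lower : ∀ p ∈ T.graph, ‖p.1‖ ^ 2 ≤ (⟪p.1, p.2 + (c : ℂ) • p.1⟫_ℂ).re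
  adjoint : ∀ f h, (∀ φ, ⟪h, A φ⟫_ℂ = ⟪f, B φ⟫_ℂ) → (f, h) ∈ T.graph

namespace IsSemiboundedCore

variable {T : H →ₗ.[ℂ] H} {A B : M →ₗ[ℂ] H} {c : ℝ}

theorem norm_le (hT : IsSemiboundedCore T A B c) {f h : H} (hf : (f, h) ∈ T.graph) :
    ‖f‖ ≤ ‖h + (c : ℂ) • f‖ := by
  have h1 := hT.lower _ hf
  have h2 : (⟪f, h + (c : ℂ) • f⟫_ℂ).re ≤ ‖f‖ * ‖h + (c : ℂ) • f‖ :=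
    (Complex.re_le_norm _).trans (norm_inner_le_norm _ _)
  rcases (norm_nonneg f).eq_or_lt with h0 | h0
  · rw [← h0]; positivity
  · have : ‖f‖ * ‖f‖ ≤ ‖f‖ * ‖h + (c : ℂ) • f‖ := by simpa [sq] using h1.trans h2
    exact le_of_mul_le_mul_left this h0

/-- By `symm` and `adjoint`, `T` is exactly the adjoint of its restriction to the core, and the
graph of an adjoint is cut out by continuous equations. -/
theorem isClosed_graph (hT : IsSemiboundedCore T A B c) : IsClosed (T.graph : Set (H × H)) := by
  have : (T.graph : Set (H × H)) = ⋂ φ, {p : H × H | ⟪p.2, A φ⟫_ℂ = ⟪p.1, B φ⟫_ℂ} := by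
    ext p
    simp only [mem_iInter, mem_ofPred_eq, SetLike.mem_coe]
    exact ⟨fun hp φ => hT.symm p hp _ (hT.mem φ), fun hp => hT.adjoint p.1 p.2 hp⟩
  rw [this]
  exact isClosed_iInter fun φ => isClosed_eq (by fun_prop) (by fun_prop)

/-- With `R = (T + c)⁻¹`, the spectrum of `T` is the set of `z` for which `1 - (z + c) R` is not
invertible. -/
theorem mem_unboundedSpectrum_iff {R : H →L[ℂ] H}
    (hR : ∀ f h, (f, h) ∈ T.graph ↔ f = R (h + (c : ℂ) • f)) (z : ℂ) :
    z ∈ unboundedSpectrum T ↔ ¬ IsUnit (1 - (z + c) • R) := by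
  have hmem : ∀ g, (R g, g - (c : ℂ) • R g) ∈ T.graph := fun g => by rw [hR]; simp
  have hRT : ∀ f : T.domain, R (T f + (c : ℂ) • (f : H)) = f := fun f =>
    ((hR _ _).mp (T.mem_graph f)).symm
  have hdom : ∀ g, ∃ hg : R g ∈ T.domain, T ⟨R g, hg⟩ = g - (c : ℂ) • R g := fun g => by
    obtain ⟨y, h1, h2⟩ := (LinearPMap.mem_graph_iff _).mp (hmem g)
    simp only at h1 h2
    exact ⟨h1 ▸ y.2, by rw [← h2]; congr 1; exact Subtype.ext h1.symm⟩
  rw [unboundedSpectrum, mem_ofPred_eq, not_iff_not]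
  constructor
  · rintro ⟨Q, h1, h2⟩
    -- With `Q = (T - z)⁻¹`, the resolvent identity gives `(1 - (z + c) R)⁻¹ = 1 + (z + c) Q`.
    refine isUnit_iff_exists.mpr ⟨1 + (z + c) • Q, ?_, ?_⟩
    · ext g
      obtain ⟨hg, h3⟩ := h1 g
      have h4 := hRT ⟨Q g, hg⟩
      have h5 : T ⟨Q g, hg⟩ + (c : ℂ) • Q g = g + (z + c) • Q g := by
        rw [sub_eq_iff_eq_add] at h3
        rw [h3]; module
      simp only at h4
      rw [h5] at h4
      change (g + (z + c) • Q g) - (z + c) • R (g + (z + c) • Q g) = g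
      rw [h4]; module
    · ext g
      obtain ⟨hg, h3⟩ := hdom g
      have h4 := h2 ⟨R g, hg⟩
      have h5 : T ⟨R g, hg⟩ - z • R g = g - (z + c) • R g := by rw [h3]; module
      simp only at h4
      rw [h5] at h4
      change (g - (z + c) • R g) + (z + c) • Q (g - (z + c) • R g) = g
      rw [h4]; module
  · rintro hu
    obtain ⟨N, hN1, hN2⟩ := isUnit_iff_exists.mp hu
    -- Since `T - z = (1 - (z + c) R) (T + c)` formally, its inverse is `R N`.
    refine ⟨R * N, fun g => ?_, fun f => ?_⟩
    · obtain ⟨hg, h3⟩ := hdom (N g)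
      refine ⟨hg, ?_⟩
      have h4 : N g - (z + c) • R (N g) = g := congrArg (fun X : H →L[ℂ] H => X g) hN1
      change T ⟨R (N g), hg⟩ - z • R (N g) = g
      rw [h3]
      refine Eq.trans ?_ h4
      module
    · have hcomm : N * R = R * N := by
        have h5 : (1 - (z + c) • R) * R = R * (1 - (z + c) • R) := by
          simp [sub_mul, mul_sub]
        calc N * R = N * (R * (1 - (z + c) • R)) * N := by
              rw [mul_assoc, mul_assoc, hN1, mul_one]
          _ = N * (1 - (z + c) • R) * R * N := by rw [← h5]; simp only [mul_assoc]
          _ = R * N := by rw [hN2, one_mul]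
      rw [← hcomm]
      change N (R _) = f
      have h4 : N (f - (z + c) • R f) = f := congrArg (fun X : H →L[ℂ] H => X f) hN2
      have h6 : T f - z • (f : H) = (T f + (c : ℂ) • (f : H)) - (z + c) • (f : H) := by module
      rw [h6, map_sub, hRT, map_smul, h4]

variable [CompleteSpace H]

/-- A vector `k` orthogonal to the range is a weak solution of `T k = -c k`; `adjoint` makes it a
genuine one, and the lower bound forces `k = 0`. -/
theorem dense_range (hT : IsSemiboundedCore T A B c) :
    Dense (LinearMap.range (B + (c : ℂ) • A) : Set H) := by
  rw [Submodule.dense_iff_topologicalClosure_eq_top, Submodule.topologicalClosure_eq_top_iff,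
    Submodule.eq_bot_iff]
  intro k hk
  have h1 : (k, -((c : ℂ) • k)) ∈ T.graph := by
    refine hT.adjoint _ _ fun φ => ?_
    have h2 := (Submodule.mem_orthogonal' _ _).mp hk _ (LinearMap.mem_range_self _ φ)
    simp only [LinearMap.add_apply, LinearMap.smul_apply, inner_add_right, inner_smul_right] at h2
    simp only [inner_neg_left, inner_smul_left, Complex.conj_ofReal]
    linear_combination -h2
  have h2 := hT.norm_le h1
  simpa using h2

/-- The map `T + c` on the graph, a complete space, is bounded below, so its range is closed; the
range is also dense, because it contains the image of the core. Self-adjointness of the inverse is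
the symmetry of `T`. -/
theorem exists_resolvent (hT : IsSemiboundedCore T A B c) : ∃ R : H →L[ℂ] H, IsSelfAdjoint R ∧
    ∀ f h, (f, h) ∈ T.graph ↔ f = R (h + (c : ℂ) • f) := by
  let S : T.graph →L[ℂ] H :=
    ((ContinuousLinearMap.snd ℂ H H) + (c : ℂ) • (ContinuousLinearMap.fst ℂ H H)).comp
      T.graph.subtypeL
  have hS : ∀ p : T.graph, S p = p.1.2 + (c : ℂ) • p.1.1 := fun p => rfl
  have hfst : ∀ p : T.graph, ‖p.1.1‖ ≤ ‖S p‖ := fun p => hT.norm_le p.2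
  have hanti : AntilipschitzWith (1 + ‖c‖₊) S := by
    refine S.antilipschitz_of_bound fun p => ?_
    change ‖p.1‖ ≤ (1 + ‖c‖) * ‖S p‖
    have h1 := hfst p
    have h2 : ‖p.1.2‖ ≤ ‖S p‖ + ‖c‖ * ‖p.1.1‖ := by
      have : p.1.2 = S p - (c : ℂ) • p.1.1 := by rw [hS]; simp
      calc ‖p.1.2‖ = ‖S p - (c : ℂ) • p.1.1‖ := by rw [← this]
        _ ≤ ‖S p‖ + ‖(c : ℂ) • p.1.1‖ := norm_sub_le _ _
        _ = _ := by rw [norm_smul, Complex.norm_real]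
    have h3 : 0 ≤ ‖c‖ * ‖S p‖ := by positivity
    have h4 : ‖c‖ * ‖p.1.1‖ ≤ ‖c‖ * ‖S p‖ := by gcongr
    rw [Prod.norm_def]
    refine max_le ?_ ?_ <;> linarith
  have : CompleteSpace T.graph := hT.isClosed_graph.completeSpace_coe
  have hclosed : IsClosed (range S) := hanti.isClosed_range S.uniformContinuous
  have hsurj : Function.Surjective S := by
    rw [← Set.range_eq_univ]
    refine hclosed.closure_eq ▸ Dense.closure_eq ?_
    refine hT.dense_range.mono ?_
    rintro _ ⟨φ, rfl⟩
    exact ⟨⟨_, hT.mem φ⟩, rfl⟩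
  let e : T.graph ≃ₗ[ℂ] H := LinearEquiv.ofBijective S.toLinearMap ⟨hanti.injective, hsurj⟩
  have he : ∀ g, S (e.symm g) = g := fun g => e.apply_symm_apply g
  let R : H →L[ℂ] H := LinearMap.mkContinuous
    ((LinearMap.fst ℂ H H).comp (T.graph.subtype.comp e.symm.toLinearMap)) 1 (by
      intro g
      rw [one_mul]
      exact (hfst (e.symm g)).trans_eq (by rw [he]))
  have hR : ∀ g, R g = (e.symm g).1.1 := fun g => rfl
  refine ⟨R, ?_, fun f h => ⟨fun hf => ?_, fun hf => ?_⟩⟩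
  · rw [ContinuousLinearMap.isSelfAdjoint_iff_isSymmetric]
    intro x y
    change ⟪R x, y⟫_ℂ = ⟪x, R y⟫_ℂ
    rw [hR, hR]
    conv_lhs => rw [← he y]
    conv_rhs => rw [← he x]
    rw [hS, hS, inner_add_right, inner_add_left, inner_smul_right, inner_smul_left,
      hT.symm _ (e.symm x).2 _ (e.symm y).2, Complex.conj_ofReal]
  · have : h + (c : ℂ) • f = S ⟨(f, h), hf⟩ := rfl
    rw [this, hR]
    have h2 : e.symm (S ⟨(f, h), hf⟩) = ⟨(f, h), hf⟩ := e.symm_apply_apply _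
    rw [h2]
  · have h1 := he (h + (c : ℂ) • f)
    rw [hS, ← hR, ← hf] at h1
    have h2 := (e.symm (h + (c : ℂ) • f)).2
    have h3 : (e.symm (h + (c : ℂ) • f)).1 = (f, h) :=
      Prod.ext hf.symm (add_right_cancel h1)
    rwa [h3] at h2

theorem isClosed_unboundedSpectrum (hT : IsSemiboundedCore T A B c) :
    IsClosed (unboundedSpectrum T) := by
  obtain ⟨R, -, hR⟩ := hT.exists_resolvent
  have : unboundedSpectrum T = (fun z : ℂ => 1 - (z + c) • R) ⁻¹' {x | IsUnit x}ᶜ := by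
    ext z
    rw [mem_unboundedSpectrum_iff hR]; rfl
  rw [this]
  exact (Units.isOpen.isClosed_compl).preimage (by fun_prop)

/-- The number `(z + c)⁻¹` lies in the spectrum of the bounded self-adjoint operator `R`, hence is
real. -/
theorem im_eq_zero_of_mem (hT : IsSemiboundedCore T A B c) {z : ℂ}
    (hz : z ∈ unboundedSpectrum T) : z.im = 0 := by
  obtain ⟨R, hsa, hR⟩ := hT.exists_resolvent
  rw [mem_unboundedSpectrum_iff hR] at hz
  have h0 : z + c ≠ 0 := by
    intro h0
    rw [h0] at hz
    simp at hz
  have h1 : (z + c)⁻¹ ∈ spectrum ℂ R := by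
    rw [spectrum.mem_iff]
    intro h2
    refine hz ?_
    have h3 := h2.smul (Units.mk0 _ h0)
    rw [Units.smul_mk0, smul_sub, Algebra.algebraMap_eq_smul_one, smul_smul,
      mul_inv_cancel₀ h0, one_smul] at h3
    exact h3
  have h2 := hsa.mem_spectrum_eq_re h1
  have h3 : z + c = (((z + c)⁻¹.re)⁻¹ : ℝ) := by
    rw [Complex.ofReal_inv, ← h2, inv_inv]
  have h4 := congrArg Complex.im h3
  rw [Complex.ofReal_im] at h4
  simpa using h4

/-- The lower bound makes `N` injective with closed range, and for self-adjoint `N` the orthogonal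
complement of the range is the kernel. -/
theorem isUnit_of_bounded_below {N : H →L[ℂ] H} (hN : IsSelfAdjoint N) {K : ℝ}
    (h : ∀ x, ‖x‖ ≤ K * ‖N x‖) : IsUnit N := by
  rw [ContinuousLinearMap.isUnit_iff_bijective,
    ContinuousLinearMap.bijective_iff_dense_range_and_antilipschitz]
  refine ⟨?_, ⟨K.toNNReal, ?_⟩⟩
  · rw [Submodule.topologicalClosure_eq_top_iff, Submodule.eq_bot_iff]
    intro x hx
    have h1 : N x = 0 := by
      rw [← inner_self_eq_zero (𝕜 := ℂ)]
      have h2 := (Submodule.mem_orthogonal' _ _).mp hx (N (N x)) ⟨N x, rfl⟩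
      have h3 := (ContinuousLinearMap.isSelfAdjoint_iff_isSymmetric.mp hN) x (N x)
      exact h3.trans h2
    have := h x
    rw [h1] at this
    simpa using this
  · refine N.antilipschitz_of_bound fun x => (h x).trans ?_
    exact mul_le_mul_of_nonneg_right (Real.le_coe_toNNReal K) (norm_nonneg _)

/-- Otherwise `T - z` is bounded below by `ε` on the core. With `g = (T + c) φ` one has `R g = φ`
and `(1 - (z + c) R) g = (T - z) φ`; such `g` are dense, so the bound extends by continuity and
makes `1 - (z + c) R` invertible. -/
theorem exists_approx_eigenvector (hT : IsSemiboundedCore T A B c) {z : ℂ}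
    (hz : z ∈ unboundedSpectrum T) {ε : ℝ} (hε : 0 < ε) : ∃ φ, ‖B φ - z • A φ‖ < ε * ‖A φ‖ := by
  by_contra! hcon
  have hreal := hT.im_eq_zero_of_mem hz
  obtain ⟨R, hsa, hR⟩ := hT.exists_resolvent
  rw [mem_unboundedSpectrum_iff hR] at hz
  refine hz (isUnit_of_bounded_below (K := 1 + ‖z + c‖ / ε) ?_ ?_)
  · refine IsSelfAdjoint.sub (IsSelfAdjoint.one _) (IsSelfAdjoint.smul ?_ hsa)
    rw [isSelfAdjoint_iff, Complex.star_def]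
    refine Complex.conj_eq_iff_im.mpr ?_
    simp [hreal]
  · have h1 : ∀ g, ε * ‖R g‖ ≤ ‖(1 - (z + c) • R) g‖ := by
      have hcl : IsClosed {g | ε * ‖R g‖ ≤ ‖(1 - (z + c) • R) g‖} :=
        isClosed_le (by fun_prop) (by fun_prop)
      intro g
      refine hcl.closure_subset_iff.mpr ?_ (hT.dense_range g)
      rintro _ ⟨φ, rfl⟩
      have h2 : R (B φ + (c : ℂ) • A φ) = A φ := ((hR _ _).mp (hT.mem φ)).symm
      have h3 := hcon φ
      change ε * ‖R (B φ + (c : ℂ) • A φ)‖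
        ≤ ‖(B φ + (c : ℂ) • A φ) - (z + c) • R (B φ + (c : ℂ) • A φ)‖
      rw [h2]
      refine h3.trans_eq (congrArg _ ?_)
      module
    intro g
    have h2 := h1 g
    have h3 : g = (1 - (z + c) • R) g + (z + c) • R g := by simp
    have h4 : ‖R g‖ ≤ ‖(1 - (z + c) • R) g‖ / ε := by
      rw [le_div_iff₀ hε]; linarith
    calc ‖g‖ = ‖(1 - (z + c) • R) g + (z + c) • R g‖ := by rw [← h3]
      _ ≤ ‖(1 - (z + c) • R) g‖ + ‖z + c‖ * ‖R g‖ :=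
        (norm_add_le _ _).trans_eq (by rw [norm_smul])
      _ ≤ ‖(1 - (z + c) • R) g‖ + ‖z + c‖ * (‖(1 - (z + c) • R) g‖ / ε) := by gcongr
      _ = _ := by ring

/-- Outside the spectrum, `(T - z)⁻¹ = R N` is bounded and self-adjoint, and `φ` shows that its norm
is at least `ε⁻¹`. The norm equals the spectral radius and is attained at some `w` in the spectrum
of `R N`; then `z + w⁻¹` lies in the spectrum of `T`. -/
theorem exists_mem_spectrum_of_approx (hT : IsSemiboundedCore T A B c) {z : ℂ} (hz : z.im = 0)
    {ε : ℝ} {φ : M} (hφ : ‖B φ - z • A φ‖ < ε * ‖A φ‖) :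
    ∃ w ∈ unboundedSpectrum T, ‖w - z‖ ≤ ε := by
  by_cases hzs : z ∈ unboundedSpectrum T
  · refine ⟨z, hzs, ?_⟩
    rw [sub_self, norm_zero]
    by_contra! h
    have h1 := norm_nonneg (B φ - z • A φ)
    have h2 := norm_nonneg (A φ)
    nlinarith
  obtain ⟨R, hsa, hR⟩ := hT.exists_resolvent
  have hu := hzs
  rw [mem_unboundedSpectrum_iff hR, not_not] at hu
  obtain ⟨N, hN1, hN2⟩ := isUnit_iff_exists.mp hu
  have hNsa : IsSelfAdjoint (1 - (z + c) • R) := by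
    refine IsSelfAdjoint.sub (IsSelfAdjoint.one _) (IsSelfAdjoint.smul ?_ hsa)
    rw [isSelfAdjoint_iff, Complex.star_def]
    refine Complex.conj_eq_iff_im.mpr ?_
    simp [hz]
  have hNs : star N = N := by
    have h1 : star N * (1 - (z + c) • R) = 1 := by
      have := congrArg star hN1
      rwa [star_mul, hNsa.star_eq, star_one] at this
    exact left_inv_eq_right_inv h1 hN1
  have hcomm : N * R = R * N := by
    have h5 : (1 - (z + c) • R) * R = R * (1 - (z + c) • R) := by
      simp [sub_mul, mul_sub]
    calc N * R = N * (R * (1 - (z + c) • R)) * N := by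
          rw [mul_assoc, mul_assoc, hN1, mul_one]
      _ = N * (1 - (z + c) • R) * R * N := by rw [← h5]; simp only [mul_assoc]
      _ = R * N := by rw [hN2, one_mul]
  have hQ : IsSelfAdjoint (R * N) := by
    rw [isSelfAdjoint_iff, star_mul, hNs, hsa.star_eq, hcomm]
  -- `R * N` maps `(T - z) φ` to `φ`
  have h1 : (R * N) (B φ - z • A φ) = A φ := by
    have h2 : R (B φ + (c : ℂ) • A φ) = A φ := ((hR _ _).mp (hT.mem φ)).symm
    have h3 : B φ - z • A φ = (1 - (z + c) • R) (B φ + (c : ℂ) • A φ) := by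
      change _ = (B φ + (c : ℂ) • A φ) - (z + c) • R (B φ + (c : ℂ) • A φ)
      rw [h2]; module
    rw [h3]
    change (R * (N * (1 - (z + c) • R))) (B φ + (c : ℂ) • A φ) = A φ
    rw [hN2, mul_one, h2]
  have hA : 0 < ‖A φ‖ := by
    by_contra! h
    have h0 : ‖A φ‖ = 0 := le_antisymm h (norm_nonneg _)
    rw [h0, mul_zero] at hφ
    exact absurd hφ (not_lt.mpr (norm_nonneg _))
  have : Nontrivial H := ⟨⟨A φ, 0, norm_pos_iff.mp hA⟩⟩
  have hQnorm : ‖A φ‖ ≤ ‖R * N‖ * ‖B φ - z • A φ‖ := by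
    conv_lhs => rw [← h1]
    exact (R * N).le_opNorm _
  have hε : 0 < ε := by
    by_contra! h
    have := norm_nonneg (B φ - z • A φ)
    nlinarith
  obtain ⟨w, hw, hwn⟩ := spectrum.exists_nnnorm_eq_spectralRadius (R * N)
  rw [hQ.spectralRadius_eq_nnnorm] at hwn
  have hwn' : ‖w‖ = ‖R * N‖ := by
    have : ‖w‖₊ = ‖R * N‖₊ := by exact_mod_cast hwn
    exact congrArg NNReal.toReal this
  have hwε : 1 ≤ ‖w‖ * ε := by
    rw [hwn']
    have h3 : ‖A φ‖ ≤ ‖R * N‖ * (ε * ‖A φ‖) := hQnorm.trans (by gcongr)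
    have h4 : 1 * ‖A φ‖ ≤ (‖R * N‖ * ε) * ‖A φ‖ := by linarith
    exact le_of_mul_le_mul_right h4 hA
  have hw0 : w ≠ 0 := by
    rintro rfl
    norm_num at hwε
  refine ⟨z + w⁻¹, ?_, ?_⟩
  · rw [mem_unboundedSpectrum_iff hR]
    intro h2
    refine (spectrum.mem_iff.mp hw) ?_
    have h3 : algebraMap ℂ (H →L[ℂ] H) w - R * N
        = w • (N * (1 - (z + w⁻¹ + c) • R)) := by
      have h4 : (1 - (z + w⁻¹ + c) • R) = (1 - (z + c) • R) - w⁻¹ • R := by module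
      rw [h4, mul_sub, hN2, smul_sub, mul_smul_comm, smul_smul, mul_inv_cancel₀ hw0, one_smul,
        hcomm, Algebra.algebraMap_eq_smul_one]
    rw [h3]
    have hNu : IsUnit N := isUnit_iff_exists.mpr ⟨_, hN2, hN1⟩
    have := (hNu.mul h2).smul (Units.mk0 _ hw0)
    rwa [Units.smul_mk0] at this
  · rw [add_sub_cancel_left, norm_inv]
    have hwp : 0 < ‖w‖ := norm_pos_iff.mpr hw0
    rw [inv_le_comm₀ hwp hε, inv_le_iff_one_le_mul₀ hε]
    exact hwε

end IsSemiboundedCore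

end SelfAdjoint

/-! ### Sobolev functions on an interval -/

section Interval

open Polynomial
open scoped ContDiff InnerProductSpace

theorem integral_Ioo_eq_intervalIntegral {L : ℝ} (hL : 0 ≤ L) (F : ℝ → ℂ) :
    ∫ x in Ioo 0 L, F x = ∫ x in (0 : ℝ)..L, F x := by
  rw [intervalIntegral.integral_of_le hL, integral_Ioc_eq_integral_Ioo]

theorem L2Interval.intervalIntegrable {L : ℝ} (hL : 0 ≤ L) (f : L2Interval L) :
    IntervalIntegrable f volume 0 L := by
  rw [intervalIntegrable_iff_integrableOn_Ioo_of_le hL]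
  exact (Lp.memLp f).integrable (by norm_num)

theorem memLp_of_continuousOn {L : ℝ} {u : ℝ → ℂ} (hu : ContinuousOn u (Icc 0 L)) :
    MemLp u 2 (volume.restrict (Ioo (0 : ℝ) L)) := by
  obtain ⟨C, hC⟩ := isCompact_Icc.exists_bound_of_continuousOn hu
  refine MemLp.of_bound ((hu.mono Ioo_subset_Icc_self).aestronglyMeasurable measurableSet_Ioo) C ?_
  filter_upwards [self_mem_ae_restrict measurableSet_Ioo] with x hx
  exact hC x (Ioo_subset_Icc_self hx)

theorem exists_isContinuousRep {L : ℝ} {u : ℝ → ℂ} (hu : ContinuousOn u (Icc 0 L)) :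
    ∃ f : L2Interval L, IsContinuousRep f u :=
  ⟨(memLp_of_continuousOn hu).toLp u, hu, MemLp.coeFn_toLp _⟩

/-- Absolute continuity of a function with increments dominated by those of an absolutely
continuous function. -/
theorem AbsolutelyContinuousOnInterval.of_dist_le {f : ℝ → ℂ} {g : ℝ → ℝ} {a b : ℝ}
    (hg : AbsolutelyContinuousOnInterval g a b)
    (h : ∀ x ∈ uIcc a b, ∀ y ∈ uIcc a b, dist (f x) (f y) ≤ dist (g x) (g y)) :
    AbsolutelyContinuousOnInterval f a b := by
  rw [absolutelyContinuousOnInterval_iff] at hg ⊢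
  intro ε hε
  obtain ⟨δ, hδ, H⟩ := hg ε hε
  refine ⟨δ, hδ, fun E hE hs => (Finset.sum_le_sum fun i hi => ?_).trans_lt (H E hE hs)⟩
  exact h _ (hE.1 i hi).1 _ (hE.1 i hi).2

/-- The increments are dominated by those of the real primitive of `‖g‖`. -/
theorem absolutelyContinuousOnInterval_primitive {L : ℝ} {g : ℝ → ℂ}
    (hg : IntervalIntegrable g volume 0 L) (c : ℂ) :
    AbsolutelyContinuousOnInterval (fun x => c + ∫ t in (0 : ℝ)..x, g t) 0 L := by
  refine AbsolutelyContinuousOnInterval.of_dist_le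
    (hg.norm.absolutelyContinuousOnInterval_intervalIntegral (c := 0) left_mem_uIcc) ?_
  intro x hx y hy
  have hx' : IntervalIntegrable g volume 0 x :=
    hg.mono_set (uIcc_subset_uIcc left_mem_uIcc hx)
  have hy' : IntervalIntegrable g volume 0 y :=
    hg.mono_set (uIcc_subset_uIcc left_mem_uIcc hy)
  rw [dist_add_left, dist_eq_norm, dist_eq_norm,
    intervalIntegral.integral_interval_sub_left hx' hy',
    intervalIntegral.integral_interval_sub_left hx'.norm hy'.norm]
  exact intervalIntegral.norm_integral_le_abs_integral_norm

/-- Integration by parts for primitives of integrable functions. -/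
theorem integral_mul_add_mul_primitive {L : ℝ} {g k : ℝ → ℂ} (c d : ℂ)
    (hg : IntervalIntegrable g volume 0 L) (hk : IntervalIntegrable k volume 0 L) :
    ∫ x in (0 : ℝ)..L, (g x * (d + ∫ t in (0 : ℝ)..x, k t) + (c + ∫ t in (0 : ℝ)..x, g t) * k x)
      = (c + ∫ t in (0 : ℝ)..L, g t) * (d + ∫ t in (0 : ℝ)..L, k t) - c * d := by
  set u : ℝ → ℂ := fun x => c + ∫ t in (0 : ℝ)..x, g t with hu
  set v : ℝ → ℂ := fun x => d + ∫ t in (0 : ℝ)..x, k t with hv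
  have hua := absolutelyContinuousOnInterval_primitive hg c
  have hva := absolutelyContinuousOnInterval_primitive hk d
  have hw : IntervalIntegrable (fun x => g x * v x + u x * k x) volume 0 L :=
    (hg.mul_continuousOn hva.continuousOn).add (hk.continuousOn_mul hua.continuousOn)
  -- The product minus the primitive of its formal derivative is absolutely continuous with
  -- derivative zero almost everywhere, hence constant; comparing both ends gives the formula.
  have hac : AbsolutelyContinuousOnInterval
      (u • v - fun x => (0 : ℂ) + ∫ t in (0 : ℝ)..x, (g t * v t + u t * k t)) 0 L :=
    (hua.smul hva).sub (absolutelyContinuousOnInterval_primitive hw 0)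
  obtain ⟨C, hC⟩ := hac.const_of_ae_hasDerivAt_zero (by
    filter_upwards [hg.ae_hasDerivAt_integral, hk.ae_hasDerivAt_integral,
      hw.ae_hasDerivAt_integral] with x h1 h2 h3 hx
    have e1 : HasDerivAt u (g x) x := (h1 hx 0 left_mem_uIcc).const_add c
    have e2 : HasDerivAt v (k x) x := (h2 hx 0 left_mem_uIcc).const_add d
    have e3 := (h3 hx 0 left_mem_uIcc).const_add (0 : ℂ)
    have e4 := (e1.mul e2).sub e3
    rwa [sub_self] at e4)
  have h0 : u 0 * v 0 - (0 + ∫ t in (0 : ℝ)..0, (g t * v t + u t * k t)) = C :=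
    hC 0 left_mem_uIcc
  have hL' : u L * v L - (0 + ∫ t in (0 : ℝ)..L, (g t * v t + u t * k t)) = C :=
    hC L right_mem_uIcc
  have hu0 : u 0 = c := by simp [hu]
  have hv0 : v 0 = d := by simp [hv]
  rw [intervalIntegral.integral_same, hu0, hv0] at h0
  change ∫ x in (0 : ℝ)..L, (g x * v x + u x * k x) = u L * v L - c * d
  linear_combination h0 - hL'

theorem continuousOn_primitive {L : ℝ} (hL : 0 ≤ L) {g : ℝ → ℂ}
    (hg : IntervalIntegrable g volume 0 L) (c : ℂ) :
    ContinuousOn (fun x => c + ∫ t in (0 : ℝ)..x, g t) (Icc 0 L) := by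
  have := (absolutelyContinuousOnInterval_primitive hg c).continuousOn
  rwa [uIcc_of_le hL] at this

/-- Functions that vanish at the ends of the interval are the primitives of their derivatives. -/
theorem eq_primitive_deriv {φ : ℝ → ℝ} (h1 : ContDiff ℝ ∞ φ) (h0 : φ 0 = 0) (x : ℝ) :
    ((φ x : ℝ) : ℂ) = 0 + ∫ t in (0 : ℝ)..x, ((deriv φ t : ℝ) : ℂ) := by
  have hd : Continuous (deriv φ) := h1.continuous_deriv (by simp)
  have h2 : ∫ t in (0 : ℝ)..x, deriv φ t = φ x - φ 0 :=
    intervalIntegral.integral_deriv_eq_sub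
      (fun t _ => (h1.differentiable (by simp)).differentiableAt) (hd.intervalIntegrable _ _)
  rw [intervalIntegral.integral_ofReal, h2, h0]
  simp

/-- A test function is the primitive of its derivative and vanishes at both ends, so integration by
parts for primitives has no boundary terms. -/
theorem HasWeakDeriv.of_eq_primitive {L : ℝ} (hL : 0 ≤ L) {f g : L2Interval L} {c : ℂ}
    (h : f =ᵐ[volume.restrict (Ioo (0 : ℝ) L)] fun x => c + ∫ t in (0 : ℝ)..x, g t) :
    HasWeakDeriv f g := by
  intro φ h1 h2 h3
  have hd : Continuous (deriv φ) := h1.continuous_deriv (by simp)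
  have hz : ∀ x, x ∉ Ioo 0 L → φ x = 0 := fun x hx =>
    image_eq_zero_of_notMem_tsupport fun h' => hx (h3 h')
  have hφ := eq_primitive_deriv h1 (hz 0 (by simp))
  have key := integral_mul_add_mul_primitive c 0 (g.intervalIntegrable hL)
    ((Complex.continuous_ofReal.comp hd).intervalIntegrable 0 L)
  simp only [Function.comp_apply, ← hφ] at key
  rw [hz L (by simp), Complex.ofReal_zero, mul_zero, mul_zero, sub_zero,
    ← integral_Ioo_eq_intervalIntegral hL] at key
  have e1 : ∫ x in Ioo 0 L, deriv φ x • f x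
      = ∫ x in Ioo 0 L, (c + ∫ t in (0 : ℝ)..x, g t) * ((deriv φ x : ℝ) : ℂ) := by
    refine integral_congr_ae ?_
    filter_upwards [h] with x hx
    rw [hx, Complex.real_smul, mul_comm]
  have e2 : ∫ x in Ioo 0 L, φ x • g x = ∫ x in Ioo 0 L, g x * ((φ x : ℝ) : ℂ) := by
    refine integral_congr_ae (Filter.Eventually.of_forall fun x => ?_)
    simp only [Complex.real_smul, mul_comm]
  rw [e1, e2, eq_neg_iff_add_eq_zero, add_comm, ← integral_add, key]
  · refine (g.integrable_smul h1.continuous h2).congr (Filter.Eventually.of_forall fun x => ?_)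
    simp only [Complex.real_smul, mul_comm]
  · refine (f.integrable_smul hd h2.deriv).congr ?_
    filter_upwards [h] with x hx
    rw [hx, Complex.real_smul, mul_comm]

/-- The restriction of a polynomial to the interval, as an element of `L²`. -/
def polyLp (L : ℝ) : ℂ[X] →ₗ[ℂ] L2Interval L where
  toFun P := (memLp_of_continuousOn (L := L) (u := fun x : ℝ => P.eval (x : ℂ))
    (by fun_prop)).toLp _
  map_add' P Q := by
    rw [← MemLp.toLp_add, MemLp.toLp_eq_toLp_iff]
    exact Filter.Eventually.of_forall fun x => by simp
  map_smul' c P := by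
    rw [RingHom.id_apply, ← MemLp.toLp_const_smul, MemLp.toLp_eq_toLp_iff]
    exact Filter.Eventually.of_forall fun x => by simp

theorem isContinuousRep_polyLp (L : ℝ) (P : ℂ[X]) :
    IsContinuousRep (polyLp L P) (fun x : ℝ => P.eval (x : ℂ)) :=
  ⟨by fun_prop, MemLp.coeFn_toLp (memLp_of_continuousOn (by fun_prop))⟩

theorem eval_eq_primitive (P : ℂ[X]) (x : ℝ) :
    P.eval (x : ℂ) = P.eval 0 + ∫ t in (0 : ℝ)..x, (derivative P).eval (t : ℂ) := by
  have h : ∀ t : ℝ, HasDerivAt (fun t : ℝ => P.eval (t : ℂ)) ((derivative P).eval (t : ℂ)) t :=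
    fun t => (P.hasDerivAt (t : ℂ)).comp_ofReal
  rw [intervalIntegral.integral_eq_sub_of_hasDerivAt (fun t _ => h t)
    (Continuous.intervalIntegrable (by fun_prop) _ _)]
  simp

theorem hasWeakDeriv_polyLp {L : ℝ} (hL : 0 ≤ L) (P : ℂ[X]) :
    HasWeakDeriv (polyLp L P) (polyLp L (derivative P)) := by
  refine HasWeakDeriv.of_eq_primitive hL (c := P.eval 0) ?_
  filter_upwards [(isContinuousRep_polyLp L P).2, self_mem_ae_restrict measurableSet_Ioo]
    with x hx hxL
  rw [hx, eval_eq_primitive]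
  congr 1
  refine intervalIntegral.integral_congr_ae_restrict ?_
  rw [uIoc_of_le hxL.1.le]
  have hsub : Ioc 0 x ⊆ Ioo 0 L := fun t ht => ⟨ht.1, ht.2.trans_lt hxL.2⟩
  have h1 := ae_restrict_of_ae_restrict_of_subset hsub (isContinuousRep_polyLp L (derivative P)).2
  filter_upwards [h1] with t ht using ht.symm

/-- du Bois-Reymond: a function with vanishing weak derivative is constant. -/
theorem HasWeakDeriv.eq_const {L : ℝ} (hL : 0 < L) {F : L2Interval L} (hF : HasWeakDeriv F 0) :
    ∃ c : ℂ, F = polyLp L (C c) := by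
  -- The bump `η` serves to define the constant as the `η`-weighted mean of `F`.
  obtain ⟨η, hη1, hη2, hη3, hη4, hη5⟩ := exists_contDiff_tsupport_subset (n := ⊤)
    (Ioo_mem_nhds (show (0 : ℝ) < L / 2 by linarith) (show L / 2 < L by linarith))
  have hηpos : 0 < ∫ x, η x :=
    hη3.continuous.integral_pos_of_hasCompactSupport_nonneg_nonzero hη2
      (fun x => (hη4 (mem_range_self x)).1) (x := L / 2) (by rw [hη5]; exact one_ne_zero)
  set m := ∫ x, η x with hm
  set c : ℂ := m⁻¹ • ∫ x in Ioo 0 L, η x • F x with hc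
  refine ⟨c, ?_⟩
  rw [← sub_eq_zero]
  -- It suffices that `F - c` integrates to zero against every test function, which is to say that
  -- it is a weak derivative of `0`.
  refine HasWeakDeriv.eq_zero fun φ h1 h2 h3 => ?_
  -- Subtracting a multiple of `η` gives `φ` integral zero; its primitive `Ψ` then has compact
  -- support in the interval and is itself a test function.
  have key : ∫ x in Ioo 0 L, (φ x - (m⁻¹ * ∫ y, φ y) * η x) • F x = 0 := by
    set ψ : ℝ → ℝ := fun x => φ x - (m⁻¹ * ∫ y, φ y) * η x with hψ
    have hψs : ContDiff ℝ ∞ ψ := h1.sub (contDiff_const.mul hη3)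
    have hψc : Continuous ψ := hψs.continuous
    have hψi : ∫ x, ψ x = 0 := by
      rw [integral_sub (h1.continuous.integrable_of_hasCompactSupport h2)
        ((hη3.continuous.integrable_of_hasCompactSupport hη2).const_mul _), integral_const_mul]
      rw [← hm]
      field_simp
      ring
    have hK : IsCompact (tsupport φ ∪ tsupport η) := h2.isCompact.union hη2.isCompact
    have hKn : (tsupport φ ∪ tsupport η).Nonempty :=
      ⟨L / 2, Or.inr (subset_tsupport _ (by rw [Function.mem_support, hη5]; exact one_ne_zero))⟩
    have hKs : tsupport φ ∪ tsupport η ⊆ Ioo 0 L := union_subset h3 hη1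
    obtain ⟨a, haK, ha⟩ := hK.exists_isLeast hKn
    obtain ⟨b, hbK, hb⟩ := hK.exists_isGreatest hKn
    have hψz : ∀ x, x ∉ Icc a b → ψ x = 0 := by
      intro x hx
      have h5 : x ∉ tsupport φ ∪ tsupport η := fun h => hx ⟨ha h, hb h⟩
      rw [mem_union, not_or] at h5
      simp only [hψ, image_eq_zero_of_notMem_tsupport h5.1, image_eq_zero_of_notMem_tsupport h5.2,
        mul_zero, sub_zero]
    set Ψ : ℝ → ℝ := fun x => ∫ t in (0 : ℝ)..x, ψ t with hΨ
    have hΨd : ∀ x, HasDerivAt Ψ (ψ x) x := fun x =>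
      intervalIntegral.integral_hasDerivAt_right (hψc.intervalIntegrable _ _)
        (hψc.stronglyMeasurableAtFilter _ _) hψc.continuousAt
    have hΨ' : deriv Ψ = ψ := funext fun x => (hΨd x).deriv
    have hΨs : ContDiff ℝ ∞ Ψ := by
      rw [contDiff_infty_iff_deriv, hΨ']
      exact ⟨fun x => (hΨd x).differentiableAt, hψs⟩
    have hΨz : ∀ x, x ∉ Icc a b → Ψ x = 0 := by
      intro x hx
      by_cases hxa : x < a
      · refine intervalIntegral.integral_zero_ae (Filter.Eventually.of_forall fun t ht => hψz t ?_)
        intro h6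
        have h7 : max 0 x < a := max_lt (hKs haK).1 hxa
        exact absurd (ht.2.trans_lt h7) (not_lt.mpr h6.1)
      · have hxb : b < x := by
          by_contra! h
          exact hx ⟨not_lt.mp hxa, h⟩
        rw [← hψi]
        refine intervalIntegral.integral_eq_integral_of_support_subset fun t ht => ?_
        have h6 : t ∈ Icc a b := by
          by_contra h
          exact ht (hψz t h)
        exact ⟨(hKs haK).1.trans_le h6.1, h6.2.trans hxb.le⟩
    have hΨt : tsupport Ψ ⊆ Icc a b := closure_minimal (fun t ht => by
      by_contra h
      exact ht (hΨz t h)) isClosed_Icc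
    have h8 := hF Ψ hΨs (HasCompactSupport.intro isCompact_Icc hΨz)
      (hΨt.trans fun t ht => ⟨(hKs haK).1.trans_le ht.1, ht.2.trans_lt (hKs hbK).2⟩)
    rw [hΨ'] at h8
    rw [h8, neg_eq_zero]
    refine integral_eq_zero_of_ae ?_
    filter_upwards [Lp.coeFn_zero ℂ 2 (volume.restrict (Ioo (0 : ℝ) L))] with x hx
    rw [hx]
    simp
  have e0 : ∫ x in Ioo 0 L, deriv φ x • (0 : L2Interval L) x = 0 := by
    refine integral_eq_zero_of_ae ?_
    filter_upwards [Lp.coeFn_zero ℂ 2 (volume.restrict (Ioo (0 : ℝ) L))] with x hx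
    rw [hx]
    simp
  have e1 : ∫ x in Ioo 0 L, φ x • (F - polyLp L (C c) : L2Interval L) x
      = (∫ x in Ioo 0 L, φ x • F x) - (∫ x, φ x) • c := by
    have h5 : ∫ x in Ioo 0 L, φ x • c = (∫ x, φ x) • c := by
      rw [integral_smul_const, setIntegral_eq_integral_of_forall_compl_eq_zero]
      exact fun x hx => image_eq_zero_of_notMem_tsupport fun h' => hx (h3 h')
    rw [← h5, ← integral_sub (F.integrable_smul h1.continuous h2)]
    · refine integral_congr_ae ?_
      filter_upwards [Lp.coeFn_sub F (polyLp L (C c)), (isContinuousRep_polyLp L (C c)).2]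
        with x hx hx2
      rw [hx, Pi.sub_apply, hx2, eval_C, smul_sub]
    · exact ((h1.continuous.integrable_of_hasCompactSupport h2).smul_const c).integrableOn
  have e2 : ∫ x in Ioo 0 L, (φ x - (m⁻¹ * ∫ y, φ y) * η x) • F x
      = (∫ x in Ioo 0 L, φ x • F x) - (∫ x, φ x) • c := by
    have hint : Integrable (fun x => (m⁻¹ * ∫ y, φ y) • η x • F x)
        (volume.restrict (Ioo 0 L)) := (F.integrable_smul hη3.continuous hη2).smul (m⁻¹ * ∫ y, φ y)
    rw [hc, smul_smul, mul_comm _ m⁻¹, ← integral_smul,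
      ← integral_sub (F.integrable_smul h1.continuous h2) hint]
    refine integral_congr_ae (Filter.Eventually.of_forall fun x => ?_)
    simp only [sub_smul, mul_smul]
  rw [e0, e1, ← e2, key, neg_zero]

theorem HasWeakDeriv.sub {L : ℝ} {f g f₁ g₁ : L2Interval L} (hf : HasWeakDeriv f f₁)
    (hg : HasWeakDeriv g g₁) : HasWeakDeriv (f - g) (f₁ - g₁) := by
  have := hf.add (hg.smul (-1))
  simpa [sub_eq_add_neg] using this

/-- The fundamental theorem of calculus for weak derivatives. -/
theorem HasWeakDeriv.eq_primitive {L : ℝ} (hL : 0 < L) {f g : L2Interval L}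
    (h : HasWeakDeriv f g) {u : ℝ → ℂ} (hu : IsContinuousRep f u) {x : ℝ} (hx : x ∈ Icc 0 L) :
    u x = u 0 + ∫ t in (0 : ℝ)..x, g t := by
  have hg := g.intervalIntegrable hL.le
  have hcont := continuousOn_primitive hL.le hg 0
  obtain ⟨f₀, hf₀⟩ := exists_isContinuousRep hcont
  have hd : HasWeakDeriv (f - f₀) 0 := by
    have := h.sub (HasWeakDeriv.of_eq_primitive hL.le hf₀.2)
    rwa [sub_self] at this
  obtain ⟨c, hc⟩ := hd.eq_const hL
  have hae : (fun x => u x - (0 + ∫ t in (0 : ℝ)..x, g t))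
      =ᵐ[volume.restrict (Ioo (0 : ℝ) L)] fun _ => c := by
    filter_upwards [hu.2, hf₀.2, Lp.coeFn_sub f f₀, (isContinuousRep_polyLp L (C c)).2]
      with x h1 h2 h3 h4
    rw [hc, h4, Pi.sub_apply, h1, h2, eval_C] at h3
    exact h3.symm
  have heq : EqOn (fun x => u x - (0 + ∫ t in (0 : ℝ)..x, g t)) (fun _ => c) (Icc 0 L) := by
    have h1 : EqOn (fun x => u x - (0 + ∫ t in (0 : ℝ)..x, g t)) (fun _ => c) (Ioo 0 L) :=
      Measure.eqOn_open_of_ae_eq hae isOpen_Ioo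
        ((hu.1.sub hcont).mono Ioo_subset_Icc_self) continuousOn_const
    refine h1.of_subset_closure (hu.1.sub hcont) continuousOn_const Ioo_subset_Icc_self ?_
    rw [closure_Ioo hL.ne]
  have h0 := heq (left_mem_Icc.mpr hL.le)
  have h1 := heq hx
  simp only [intervalIntegral.integral_same, zero_add, sub_zero] at h0 h1
  rw [h0, ← h1]
  ring

/-- Integration by parts for weak derivatives. -/
theorem HasWeakDeriv.inner_add_inner {L : ℝ} (hL : 0 < L) {f f₁ g g₁ : L2Interval L} {u v : ℝ → ℂ}
    (hf : HasWeakDeriv f f₁) (hu : IsContinuousRep f u) (hg : HasWeakDeriv g g₁)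
    (hv : IsContinuousRep g v) :
    ⟪f₁, g⟫_ℂ + ⟪f, g₁⟫_ℂ
      = (starRingEnd ℂ) (u L) * v L - (starRingEnd ℂ) (u 0) * v 0 := by
  have hf₁ := f₁.intervalIntegrable hL.le
  have hg₁ := g₁.intervalIntegrable hL.le
  have hstar : IntervalIntegrable (fun x => (starRingEnd ℂ) (f₁ x)) volume 0 L := by
    rw [intervalIntegrable_iff] at hf₁ ⊢
    exact (Complex.conjLIE.integrable_comp_iff (φ := f₁)).mpr hf₁
  have hprim : ∀ x ∈ Icc 0 L, (starRingEnd ℂ) (u x)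
      = (starRingEnd ℂ) (u 0) + ∫ t in (0 : ℝ)..x, (starRingEnd ℂ) (f₁ t) := by
    intro x hx
    rw [hf.eq_primitive hL hu hx, map_add]
    congr 1
    rw [intervalIntegral.integral_of_le hx.1, intervalIntegral.integral_of_le hx.1]
    exact integral_conj.symm
  have key := integral_mul_add_mul_primitive ((starRingEnd ℂ) (u 0)) (v 0) hstar hg₁
  rw [← hprim L (right_mem_Icc.mpr hL.le), ← hg.eq_primitive hL hv (right_mem_Icc.mpr hL.le)] at key
  rw [← key, L2.inner_def, L2.inner_def, ← integral_add (L2.integrable_inner _ _)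
    (L2.integrable_inner _ _), ← integral_Ioo_eq_intervalIntegral hL.le]
  refine integral_congr_ae ?_
  filter_upwards [hu.2, hv.2, self_mem_ae_restrict measurableSet_Ioo] with x h1 h2 hx
  have hx' := Ioo_subset_Icc_self hx
  rw [RCLike.inner_apply', RCLike.inner_apply', h1, h2, ← hprim x hx', ← hg.eq_primitive hL hv hx']

end Interval

/-! ### Density of polynomials, H² regularity, and inequalities uniform in the length -/

section Interval

open Polynomial
open scoped ContDiff InnerProductSpace

theorem norm_le_sqrt_mul_of_ae_bound {L : ℝ} (hL : 0 ≤ L) (f : L2Interval L) {K : ℝ} (hK : 0 ≤ K)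
    (h : ∀ᵐ x ∂volume.restrict (Ioo (0 : ℝ) L), ‖f x‖ ≤ K) : ‖f‖ ≤ K * √L := by
  have h1 := Lp.norm_le_of_ae_bound hK h
  have h2 : (measureUnivNNReal (volume.restrict (Ioo (0 : ℝ) L)) : ℝ) = L := by
    rw [measureUnivNNReal, Measure.restrict_apply_univ, Real.volume_Ioo, sub_zero,
      ENNReal.coe_toNNReal_eq_toReal, ENNReal.toReal_ofReal hL]
  rw [h2] at h1
  rw [Real.sqrt_eq_rpow, mul_comm]
  simpa using h1

theorem norm_polyLp_le {L : ℝ} (hL : 0 ≤ L) (P : ℂ[X]) {K : ℝ} (hK : 0 ≤ K)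
    (h : ∀ x ∈ Ioo (0 : ℝ) L, ‖P.eval (x : ℂ)‖ ≤ K) : ‖polyLp L P‖ ≤ K * √L := by
  refine norm_le_sqrt_mul_of_ae_bound hL _ hK ?_
  filter_upwards [(isContinuousRep_polyLp L P).2, self_mem_ae_restrict measurableSet_Ioo]
    with x h1 h2
  rw [h1]
  exact h x h2

theorem L2Interval.norm_sq_eq_integral {L : ℝ} (f : L2Interval L) :
    ‖f‖ ^ 2 = ∫ x in Ioo 0 L, ‖f x‖ ^ 2 := by
  have h1 : (‖f‖ : ℂ) ^ 2 = ⟪f, f⟫_ℂ := (inner_self_eq_norm_sq_to_K f).symm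
  have h2 : ⟪f, f⟫_ℂ = ((∫ x in Ioo 0 L, ‖f x‖ ^ 2 : ℝ) : ℂ) := by
    rw [L2.inner_def, ← integral_complex_ofReal]
    refine integral_congr_ae (Filter.Eventually.of_forall fun x => ?_)
    simp only [inner_self_eq_norm_sq_to_K]
    push_cast
    rfl
  rw [h2] at h1
  exact_mod_cast h1

theorem norm_sq_polyLp {L : ℝ} (hL : 0 ≤ L) (P : ℂ[X]) :
    ‖polyLp L P‖ ^ 2 = ∫ x in (0 : ℝ)..L, ‖P.eval (x : ℂ)‖ ^ 2 := by
  rw [L2Interval.norm_sq_eq_integral, intervalIntegral.integral_of_le hL,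
    integral_Ioc_eq_integral_Ioo]
  refine integral_congr_ae ?_
  filter_upwards [(isContinuousRep_polyLp L P).2] with x h1
  rw [h1]

theorem L2Interval.integral_norm_le {L : ℝ} (hL : 0 < L) (f : L2Interval L) :
    ∫ x in Ioo 0 L, ‖f x‖ ≤ √L * ‖f‖ := by
  have hi : Integrable f (volume.restrict (Ioo (0 : ℝ) L)) := (Lp.memLp f).integrable (by norm_num)
  have hi2 : Integrable (fun x => ‖f x‖ ^ 2) (volume.restrict (Ioo (0 : ℝ) L)) :=
    (Lp.memLp f).integrable_norm_pow (by norm_num)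
  set I := ∫ x in Ioo 0 L, ‖f x‖ with hI
  have hIn : 0 ≤ I := integral_nonneg fun _ => norm_nonneg _
  -- Cauchy–Schwarz in the form that the variance of `‖f‖` is nonnegative, with `I / L` the mean.
  have h0 : 0 ≤ ∫ x in Ioo 0 L, (‖f x‖ ^ 2 - 2 * (I / L) * ‖f x‖ + (I / L) ^ 2) :=
    integral_nonneg fun x => by
      have : ‖f x‖ ^ 2 - 2 * (I / L) * ‖f x‖ + (I / L) ^ 2 = (‖f x‖ - I / L) ^ 2 := by ring
      simp only [this]
      positivity
  have hi3 : Integrable (fun x => ‖f x‖ ^ 2 - 2 * (I / L) * ‖f x‖)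
      (volume.restrict (Ioo (0 : ℝ) L)) := hi2.sub (hi.norm.const_mul _)
  rw [integral_add hi3 (integrable_const _), integral_sub hi2 (hi.norm.const_mul _), integral_const_mul,
    ← f.norm_sq_eq_integral,
    setIntegral_const, Real.volume_real_Ioo_of_le hL.le, smul_eq_mul, ← hI] at h0
  have h1 : I ^ 2 ≤ L * ‖f‖ ^ 2 := by
    have h2 : ‖f‖ ^ 2 - 2 * (I / L) * I + (L - 0) * (I / L) ^ 2 = ‖f‖ ^ 2 - I ^ 2 / L := by
      field_simp
      ring
    rw [h2, sub_nonneg, div_le_iff₀ hL] at h0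
    linarith
  refine abs_le_of_sq_le_sq' ?_ (by positivity) |>.2
  rw [mul_pow, Real.sq_sqrt hL.le]
  exact h1

/-- Polynomials are dense in `L²(0, L)`. -/
theorem eq_zero_of_inner_polyLp {L : ℝ} {F : L2Interval L} (hF : ∀ P, ⟪F, polyLp L P⟫_ℂ = 0) :
    F = 0 := by
  refine HasWeakDeriv.eq_zero fun φ h1 h2 h3 => ?_
  have hi : Integrable F (volume.restrict (Ioo (0 : ℝ) L)) := (Lp.memLp F).integrable (by norm_num)
  have e0 : ∫ x in Ioo 0 L, deriv φ x • (0 : L2Interval L) x = 0 := by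
    refine integral_eq_zero_of_ae ?_
    filter_upwards [Lp.coeFn_zero ℂ 2 (volume.restrict (Ioo (0 : ℝ) L))] with x hx
    rw [hx]
    simp
  -- Weierstrass: `φ` is uniformly within `ε` of a polynomial, which integrates to zero against `F`.
  have key : ∀ ε > 0, ‖∫ x in Ioo 0 L, φ x • F x‖ ≤ ε * ∫ x in Ioo 0 L, ‖F x‖ := by
    intro ε hε
    obtain ⟨p, hp⟩ := exists_polynomial_near_of_continuousOn 0 L φ h1.continuous.continuousOn ε hε
    have hpF : ∫ x in Ioo 0 L, p.eval x • F x = 0 := by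
      have h4 : ⟪polyLp L (p.map (algebraMap ℝ ℂ)), F⟫_ℂ = 0 := by
        rw [← inner_conj_symm, hF, map_zero]
      rw [← h4, L2.inner_def]
      refine integral_congr_ae ?_
      filter_upwards [(isContinuousRep_polyLp L (p.map (algebraMap ℝ ℂ))).2] with x hx
      rw [hx, RCLike.inner_apply', Complex.real_smul]
      congr 1
      have : (x : ℂ) = algebraMap ℝ ℂ x := rfl
      rw [this, eval_map_algebraMap, aeval_algebraMap_apply, coe_aeval_eq_eval]
      simp
    have hint : Integrable (fun x => p.eval x • F x) (volume.restrict (Ioo 0 L)) := by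
      have hb : ContinuousOn (fun x => p.eval x) (Icc 0 L) := p.continuous.continuousOn
      obtain ⟨K, hK⟩ := isCompact_Icc.exists_bound_of_continuousOn hb
      refine hi.bdd_smul K p.continuous.aestronglyMeasurable ?_
      filter_upwards [self_mem_ae_restrict measurableSet_Ioo] with x hx
      exact hK x (Ioo_subset_Icc_self hx)
    have h5 : ∫ x in Ioo 0 L, φ x • F x = ∫ x in Ioo 0 L, (φ x - p.eval x) • F x := by
      simp only [sub_smul]
      rw [integral_sub (F.integrable_smul h1.continuous h2) hint, hpF, sub_zero]
    rw [h5, ← integral_const_mul]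
    refine norm_integral_le_of_norm_le (hi.norm.const_mul ε) ?_
    filter_upwards [self_mem_ae_restrict measurableSet_Ioo] with x hx
    rw [norm_smul]
    refine mul_le_mul_of_nonneg_right ?_ (norm_nonneg _)
    rw [← norm_neg, neg_sub]
    exact (hp x (Ioo_subset_Icc_self hx)).le
  have hz : ‖∫ x in Ioo 0 L, φ x • F x‖ ≤ 0 := by
    refine le_of_forall_pos_le_add fun ε hε => ?_
    set I := ∫ x in Ioo 0 L, ‖F x‖ with hI
    have hIn : 0 ≤ I := integral_nonneg fun _ => norm_nonneg _
    have h6 := key (ε / (I + 1)) (by positivity)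
    refine h6.trans ?_
    rw [zero_add, div_mul_eq_mul_div, div_le_iff₀ (by positivity)]
    nlinarith
  rw [e0, norm_le_zero_iff.mp hz, neg_zero]

theorem exists_derivative_eq (P : ℂ[X]) : ∃ Q : ℂ[X], derivative Q = P := by
  induction P using Polynomial.induction_on' with
  | add P Q hP hQ =>
    obtain ⟨P', rfl⟩ := hP
    obtain ⟨Q', rfl⟩ := hQ
    exact ⟨P' + Q', derivative_add⟩
  | monomial n a =>
    refine ⟨monomial (n + 1) (a / (n + 1)), ?_⟩
    rw [derivative_monomial]
    have : (n : ℂ) + 1 ≠ 0 := by exact_mod_cast n.succ_ne_zero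
    simp only [Nat.add_sub_cancel]
    congr 1
    push_cast
    field_simp

/-- The cubic polynomial with values `a₀`, `b₀` and derivatives `a₁`, `b₁` at `0`, `L`. -/
def hermiteCubic (L : ℝ) (a₀ a₁ b₀ b₁ : ℂ) : ℂ[X] :=
  C a₀ + C a₁ * X + C (3 * (b₀ - a₀) * (L : ℂ)⁻¹ ^ 2 - (2 * a₁ + b₁) * (L : ℂ)⁻¹) * X ^ 2
    + C (2 * (a₀ - b₀) * (L : ℂ)⁻¹ ^ 3 + (a₁ + b₁) * (L : ℂ)⁻¹ ^ 2) * X ^ 3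

theorem hermiteCubic_zero (L : ℝ) : hermiteCubic L 0 0 0 0 = 0 := by simp [hermiteCubic]

theorem eval_hermiteCubic (L : ℝ) (a₀ a₁ b₀ b₁ x : ℂ) : (hermiteCubic L a₀ a₁ b₀ b₁).eval x =
    a₀ + a₁ * x + (3 * (b₀ - a₀) * (L : ℂ)⁻¹ ^ 2 - (2 * a₁ + b₁) * (L : ℂ)⁻¹) * x ^ 2
    + (2 * (a₀ - b₀) * (L : ℂ)⁻¹ ^ 3 + (a₁ + b₁) * (L : ℂ)⁻¹ ^ 2) * x ^ 3 := by
  simp [hermiteCubic]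

theorem eval_derivative_hermiteCubic (L : ℝ) (a₀ a₁ b₀ b₁ x : ℂ) :
    (derivative (hermiteCubic L a₀ a₁ b₀ b₁)).eval x =
    a₁ + 2 * (3 * (b₀ - a₀) * (L : ℂ)⁻¹ ^ 2 - (2 * a₁ + b₁) * (L : ℂ)⁻¹) * x
    + 3 * (2 * (a₀ - b₀) * (L : ℂ)⁻¹ ^ 3 + (a₁ + b₁) * (L : ℂ)⁻¹ ^ 2) * x ^ 2 := by
  simp [hermiteCubic]
  ring

theorem derivative_derivative_hermiteCubic (L : ℝ) (a₀ a₁ b₀ b₁ : ℂ) :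
    derivative (derivative (hermiteCubic L a₀ a₁ b₀ b₁)) =
    C (2 * (3 * (b₀ - a₀) * (L : ℂ)⁻¹ ^ 2 - (2 * a₁ + b₁) * (L : ℂ)⁻¹))
    + C (6 * (2 * (a₀ - b₀) * (L : ℂ)⁻¹ ^ 3 + (a₁ + b₁) * (L : ℂ)⁻¹ ^ 2)) * X := by
  refine Polynomial.funext fun x => ?_
  simp [hermiteCubic]
  ring

theorem eval_hermiteCubic_left (L : ℝ) (a₀ a₁ b₀ b₁ : ℂ) : (hermiteCubic L a₀ a₁ b₀ b₁).eval 0 = a₀ := by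
  simp [eval_hermiteCubic]

theorem eval_derivative_hermiteCubic_left (L : ℝ) (a₀ a₁ b₀ b₁ : ℂ) :
    (derivative (hermiteCubic L a₀ a₁ b₀ b₁)).eval 0 = a₁ := by
  simp [eval_derivative_hermiteCubic]

theorem eval_hermiteCubic_right {L : ℝ} (hL : L ≠ 0) (a₀ a₁ b₀ b₁ : ℂ) :
    (hermiteCubic L a₀ a₁ b₀ b₁).eval (L : ℂ) = b₀ := by
  have : (L : ℂ) ≠ 0 := by exact_mod_cast hL
  rw [eval_hermiteCubic]
  field_simp
  ring

theorem eval_derivative_hermiteCubic_right {L : ℝ} (hL : L ≠ 0) (a₀ a₁ b₀ b₁ : ℂ) :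
    (derivative (hermiteCubic L a₀ a₁ b₀ b₁)).eval (L : ℂ) = b₁ := by
  have : (L : ℂ) ≠ 0 := by exact_mod_cast hL
  rw [eval_derivative_hermiteCubic]
  field_simp
  ring

/-- `f ∈ H²(0, L)` with `f'` and `-f'' = h`, and `u`, `u'` are the continuous representatives of
`f` and `f'`. -/
structure IsH2 {L : ℝ} (f f' h : L2Interval L) (u u' : ℝ → ℂ) : Prop where
  deriv : HasWeakDeriv f f'
  deriv' : HasWeakDeriv f' (-h)
  rep : IsContinuousRep f u
  rep' : IsContinuousRep f' u'

theorem isH2_polyLp {L : ℝ} (hL : 0 ≤ L) (P : ℂ[X]) :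
    IsH2 (polyLp L P) (polyLp L (derivative P)) (polyLp L (-derivative (derivative P)))
      (fun x => P.eval (x : ℂ)) (fun x => (derivative P).eval (x : ℂ)) where
  deriv := hasWeakDeriv_polyLp hL P
  deriv' := by
    rw [map_neg, neg_neg]
    exact hasWeakDeriv_polyLp hL _
  rep := isContinuousRep_polyLp L P
  rep' := isContinuousRep_polyLp L _

namespace IsH2

variable {L : ℝ} {f f' h g g' k : L2Interval L} {u u' v v' : ℝ → ℂ}

/-- One half of Green's formula; subtracting it from `inner_left` leaves only boundary terms. -/
theorem inner_right (hL : 0 < L) (hf : IsH2 f f' h u u') (hg : IsH2 g g' k v v') :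
    ⟪f, k⟫_ℂ = ⟪f', g'⟫_ℂ
      - ((starRingEnd ℂ) (u L) * v' L - (starRingEnd ℂ) (u 0) * v' 0) := by
  have := hf.deriv.inner_add_inner hL hf.rep hg.deriv' hg.rep'
  rw [inner_neg_right] at this
  linear_combination -this

theorem inner_left (hL : 0 < L) (hf : IsH2 f f' h u u') (hg : IsH2 g g' k v v') :
    ⟪h, g⟫_ℂ = ⟪f', g'⟫_ℂ
      - ((starRingEnd ℂ) (u' L) * v L - (starRingEnd ℂ) (u' 0) * v 0) := by
  have := hf.deriv'.inner_add_inner hL hf.rep' hg.deriv hg.rep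
  rw [inner_neg_left] at this
  linear_combination -this

/-- Regularity: if `-f'' = h` in the sense of pairings with polynomials that vanish with their
derivatives at the ends of the interval, then `f ∈ H²(0, L)`. -/
theorem of_inner_polyLp (hL : 0 < L)
    (H : ∀ P : ℂ[X], P.eval 0 = 0 → P.eval (L : ℂ) = 0 → (derivative P).eval 0 = 0 →
      (derivative P).eval (L : ℂ) = 0 →
      ⟪h, polyLp L P⟫_ℂ = ⟪f, polyLp L (-derivative (derivative P))⟫_ℂ) :
    ∃ f' u u', IsH2 f f' h u u' := by
  -- The function `g₀` is a double primitive of `-h`; the rest of the proof shows that `f - g₀` is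
  -- affine.
  obtain ⟨g₁, hg₁⟩ := exists_isContinuousRep
    (continuousOn_primitive hL.le ((-h).intervalIntegrable hL.le) 0)
  have hd₁ : HasWeakDeriv g₁ (-h) := HasWeakDeriv.of_eq_primitive hL.le hg₁.2
  obtain ⟨g₀, hg₀⟩ := exists_isContinuousRep
    (continuousOn_primitive hL.le (g₁.intervalIntegrable hL.le) 0)
  have hd₀ : HasWeakDeriv g₀ g₁ := HasWeakDeriv.of_eq_primitive hL.le hg₀.2
  have hG : IsH2 g₀ g₁ h _ _ := ⟨hd₀, hd₁, hg₀, hg₁⟩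
  set K : Submodule ℂ (L2Interval L) := Submodule.span ℂ {polyLp L 1, polyLp L X} with hK
  have hKmem : ∀ a b : ℂ, polyLp L (C a + C b * X) ∈ K := by
    intro a b
    rw [hK, Submodule.mem_span_pair]
    refine ⟨a, b, ?_⟩
    rw [← map_smul, ← map_smul, ← map_add, ← C_mul', ← C_mul', mul_one]
  have : FiniteDimensional ℂ K := FiniteDimensional.span_of_finite ℂ (by simp)
  obtain ⟨a, b, hab⟩ : ∃ a b : ℂ, (K.starProjection (f - g₀)) = polyLp L (C a + C b * X) := by
    have h1 : K.starProjection (f - g₀) ∈ K := Submodule.starProjection_apply_mem _ _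
    obtain ⟨a, b, h2⟩ := Submodule.mem_span_pair.mp h1
    refine ⟨a, b, ?_⟩
    rw [← h2, ← map_smul, ← map_smul, ← map_add, ← C_mul', ← C_mul', mul_one]
  have hF : f - g₀ = polyLp L (C a + C b * X) := by
    rw [← sub_eq_zero]
    refine eq_zero_of_inner_polyLp fun P => ?_
    obtain ⟨Q', rfl⟩ := exists_derivative_eq P
    obtain ⟨Q, rfl⟩ := exists_derivative_eq Q'
    -- An arbitrary polynomial is some `Q''`. Splitting off the cubic `T` with the same boundary
    -- data leaves an admissible `P₀`. As `T''` is affine, the part of `f - g₀` orthogonal to affine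
    -- functions is orthogonal to `T''`; by the hypothesis it is orthogonal to `P₀''` as well.
    set T := hermiteCubic L (Q.eval 0) ((derivative Q).eval 0) (Q.eval (L : ℂ))
      ((derivative Q).eval (L : ℂ)) with hT
    set P₀ := Q - T with hP₀
    have z0 : P₀.eval 0 = 0 := by rw [hP₀, eval_sub, hT, eval_hermiteCubic_left, sub_self]
    have z1 : P₀.eval (L : ℂ) = 0 := by rw [hP₀, eval_sub, hT, eval_hermiteCubic_right hL.ne', sub_self]
    have z2 : (derivative P₀).eval 0 = 0 := by
      rw [hP₀, derivative_sub, eval_sub, hT, eval_derivative_hermiteCubic_left, sub_self]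
    have z3 : (derivative P₀).eval (L : ℂ) = 0 := by
      rw [hP₀, derivative_sub, eval_sub, hT, eval_derivative_hermiteCubic_right hL.ne', sub_self]
    have hdec : derivative (derivative Q)
        = derivative (derivative P₀) + derivative (derivative T) := by
      rw [hP₀, derivative_sub, derivative_sub, sub_add_cancel]
    have o1 : ⟪f - g₀ - polyLp L (C a + C b * X), polyLp L (derivative (derivative T))⟫_ℂ = 0 := by
      rw [← hab, hT, derivative_derivative_hermiteCubic]
      exact Submodule.inner_left_of_mem_orthogonal (hKmem _ _)
        (Submodule.sub_starProjection_mem_orthogonal _)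
    have green : ∀ {p p' k : L2Interval L} {w w' : ℝ → ℂ}, IsH2 p p' k w w' →
        ⟪p, polyLp L (derivative (derivative P₀))⟫_ℂ = -⟪k, polyLp L P₀⟫_ℂ := by
      intro p p' k w w' hp
      have h1 := hp.inner_right hL (isH2_polyLp hL.le P₀)
      have h2 := hp.inner_left hL (isH2_polyLp hL.le P₀)
      simp only [Complex.ofReal_zero, z0, z1, z2, z3, map_neg, inner_neg_right] at h1 h2
      linear_combination h2 - h1
    have o2 : ⟪f - g₀ - polyLp L (C a + C b * X), polyLp L (derivative (derivative P₀))⟫_ℂ = 0 := by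
      have h1 := green hG
      have h2 := green (isH2_polyLp hL.le (C a + C b * X))
      have h3 := H P₀ z0 z1 z2 z3
      have h4 : derivative (derivative (C a + C b * X)) = 0 := by simp
      rw [h4, neg_zero, map_zero, inner_zero_left, neg_zero] at h2
      rw [map_neg, inner_neg_right] at h3
      rw [inner_sub_left, inner_sub_left, h1, h2]
      linear_combination h3
    rw [hdec, map_add (polyLp L) (derivative (derivative P₀)), inner_add_right, o1, o2, add_zero]
  have hf : f = g₀ + polyLp L (C a + C b * X) := by rw [← hF]; abel
  have hA := isH2_polyLp hL.le (C a + C b * X)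
  rw [hf]
  refine ⟨_, _, _, hG.deriv.add hA.deriv, ?_, hG.rep.add hA.rep, hG.rep'.add hA.rep'⟩
  have h1 := hG.deriv'.add hA.deriv'
  have h4 : derivative (derivative (C a + C b * X)) = 0 := by simp
  rwa [h4, neg_zero, map_zero, neg_zero, add_zero] at h1

end IsH2

/-- A trace inequality, uniform for intervals of comparable lengths. -/
theorem exists_trace_bound {lmin lmax : ℝ} (hmin : 0 < lmin) {η : ℝ} (hη : 0 < η) :
    ∃ K : ℝ, 0 ≤ K ∧ ∀ L ∈ Icc lmin lmax, ∀ (f f' : L2Interval L) (u : ℝ → ℂ), HasWeakDeriv f f' →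
      IsContinuousRep f u → ‖u L‖ ^ 2 ≤ η * ‖f'‖ ^ 2 + K * ‖f‖ ^ 2 := by
  -- This size of `m` ensures `L / (2 m + 1) ≤ η / 2`, where the left side is the squared norm of
  -- `(x / L) ^ m`.
  obtain ⟨m, hm⟩ := exists_nat_gt (2 * lmax / η)
  refine ⟨2 * (m ^ 2 / lmin), by positivity, fun L hL f f' u hf hu => ?_⟩
  have hL0 : 0 < L := hmin.trans_le hL.1
  have hLc : (L : ℂ) ≠ 0 := by exact_mod_cast hL0.ne'
  have hm0 : 0 < m := by
    rw [Nat.pos_iff_ne_zero]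
    rintro rfl
    have : 0 < lmax := hL0.trans_le hL.2
    have : 0 < 2 * lmax / η := by positivity
    rw [Nat.cast_zero] at hm
    linarith
  -- Integration by parts against `(x / L) ^ m`, which is `0` at `0` and `1` at `L`, isolates `u L`.
  -- The factor of `f'` is small for large `m`; the price is the factor `m / L` from the derivative
  -- in front of `f`.
  set P : ℂ[X] := (C ((L : ℂ)⁻¹) * X) ^ m with hP
  have key := (hasWeakDeriv_polyLp hL0.le P).inner_add_inner hL0 (isContinuousRep_polyLp L P) hf hu
  have e0 : P.eval ((0 : ℝ) : ℂ) = 0 := by simp [hP, hm0.ne']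
  have e1 : P.eval (L : ℂ) = 1 := by simp [hP, hLc]
  rw [e0, e1, map_one, map_zero, one_mul, zero_mul, sub_zero] at key
  have b1 : ‖u L‖ ≤ ‖polyLp L (derivative P)‖ * ‖f‖ + ‖polyLp L P‖ * ‖f'‖ := by
    rw [← key]
    exact (norm_add_le _ _).trans (add_le_add (norm_inner_le_norm _ _) (norm_inner_le_norm _ _))
  have b2 : ‖polyLp L P‖ ^ 2 ≤ η / 2 := by
    rw [norm_sq_polyLp hL0.le]
    have h1 : ∀ x : ℝ, ‖P.eval (x : ℂ)‖ ^ 2 = (L⁻¹) ^ (2 * m) * x ^ (2 * m) := by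
      intro x
      simp only [hP, eval_pow, eval_mul, eval_C, eval_X, norm_pow, norm_mul, norm_inv,
        Complex.norm_real, Real.norm_eq_abs]
      rw [← pow_mul, mul_comm m 2, mul_pow, pow_mul, pow_mul |x|, sq_abs, inv_pow, sq_abs, ← pow_mul,
        pow_mul, inv_pow]
      congr 1
      rw [inv_pow, pow_mul]
    simp only [h1]
    rw [intervalIntegral.integral_const_mul, integral_pow, zero_pow (by omega), sub_zero]
    have h2 : L⁻¹ ^ (2 * m) * (L ^ (2 * m + 1) / ((2 * m : ℕ) + 1)) = L / (2 * m + 1) := by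
      push_cast
      rw [pow_succ, inv_pow]
      field_simp
    rw [h2, div_le_iff₀ (by positivity)]
    have h3 : 2 * lmax < m * η := by rwa [div_lt_iff₀ hη] at hm
    have h4 := hL.2
    nlinarith
  have b3 : ‖polyLp L (derivative P)‖ ≤ m * L⁻¹ * √L := by
    refine norm_polyLp_le hL0.le _ (by positivity) fun x hx => ?_
    have h1 : (derivative P).eval (x : ℂ) = m * ((L : ℂ)⁻¹ * x) ^ (m - 1) * (L : ℂ)⁻¹ := by
      rw [hP, derivative_pow]
      simp
    have h2 : ‖(L : ℂ)⁻¹ * x‖ ≤ 1 := by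
      rw [norm_mul, norm_inv, Complex.norm_real, Complex.norm_real, Real.norm_of_nonneg hL0.le,
        Real.norm_of_nonneg hx.1.le, inv_mul_le_iff₀ hL0, mul_one]
      exact hx.2.le
    rw [h1, norm_mul, norm_mul, norm_pow, norm_inv, Complex.norm_real, Real.norm_of_nonneg hL0.le,
      RCLike.norm_natCast]
    have h3 : ‖(L : ℂ)⁻¹ * x‖ ^ (m - 1) ≤ 1 := pow_le_one₀ (norm_nonneg _) h2
    have h4 : 0 ≤ (m : ℝ) := by positivity
    have h5 : 0 ≤ L⁻¹ := by positivity
    calc m * ‖(L : ℂ)⁻¹ * x‖ ^ (m - 1) * L⁻¹ ≤ m * 1 * L⁻¹ := by gcongr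
      _ = _ := by ring
  have b4 : ‖polyLp L (derivative P)‖ ^ 2 ≤ m ^ 2 / lmin := by
    have h1 : ‖polyLp L (derivative P)‖ ^ 2 ≤ (m * L⁻¹ * √L) ^ 2 := by gcongr
    have h2 : (m * L⁻¹ * √L) ^ 2 = m ^ 2 / L := by
      rw [mul_pow, mul_pow, Real.sq_sqrt hL0.le]
      field_simp
    rw [h2] at h1
    exact h1.trans (by gcongr; exact hL.1)
  calc ‖u L‖ ^ 2 ≤ (‖polyLp L (derivative P)‖ * ‖f‖ + ‖polyLp L P‖ * ‖f'‖) ^ 2 := by gcongr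
    _ ≤ 2 * ((‖polyLp L (derivative P)‖ * ‖f‖) ^ 2 + (‖polyLp L P‖ * ‖f'‖) ^ 2) := add_sq_le
    _ = 2 * ‖polyLp L (derivative P)‖ ^ 2 * ‖f‖ ^ 2 + 2 * ‖polyLp L P‖ ^ 2 * ‖f'‖ ^ 2 := by ring
    _ ≤ 2 * (m ^ 2 / lmin) * ‖f‖ ^ 2 + 2 * (η / 2) * ‖f'‖ ^ 2 := by gcongr
    _ = _ := by ring

/-- The first derivative is controlled by the function and its second derivative, uniformly for
intervals of comparable lengths. -/
theorem exists_deriv_bound {lmin lmax : ℝ} (hmin : 0 < lmin) :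
    ∃ K : ℝ, 0 ≤ K ∧ ∀ L ∈ Icc lmin lmax, ∀ (f f' h : L2Interval L) (u u' : ℝ → ℂ),
      IsH2 f f' h u u' → ‖f'‖ ^ 2 ≤ K * (‖f‖ ^ 2 + ‖h‖ ^ 2) := by
  set S := √lmax with hS
  set K₁ := (18 * lmin⁻¹ ^ 2 + 7) * S * S with hK₁
  refine ⟨2 * K₁ ^ 2, by positivity, fun L hL f f' h u u' hf => ?_⟩
  have hL0 : 0 < L := hmin.trans_le hL.1
  have hLS : √L ≤ S := Real.sqrt_le_sqrt hL.2
  have hLinv : L⁻¹ ≤ lmin⁻¹ := inv_anti₀ hmin hL.1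
  have hinv : ‖(L : ℂ)⁻¹‖ = L⁻¹ := by rw [norm_inv, Complex.norm_real, Real.norm_of_nonneg hL0.le]
  -- All boundary data of `P` vanish except `P 0 = 1`, so Green's formula expresses `u' 0` through
  -- `f` and `h`. Integrating `h` then bounds `u'` pointwise, which accounts for `7 = 6 + 1`; the
  -- numbers `6` and `18` are sums of absolute coefficients of `P` and `P''` in `x / L`.
  set P := hermiteCubic L 1 0 0 0 with hP
  have key1 := hf.inner_right hL0 (isH2_polyLp hL0.le P)
  have key2 := hf.inner_left hL0 (isH2_polyLp hL0.le P)
  simp only [Complex.ofReal_zero, hP, eval_hermiteCubic_left, eval_derivative_hermiteCubic_left,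
    eval_hermiteCubic_right hL0.ne', eval_derivative_hermiteCubic_right hL0.ne', mul_zero, sub_zero, mul_one,
    zero_sub, sub_neg_eq_add] at key1 key2
  rw [← hP] at key1 key2
  have hu0 : (starRingEnd ℂ) (u' 0) = ⟪h, polyLp L P⟫_ℂ
      - ⟪f, polyLp L (-derivative (derivative P))⟫_ℂ := by
    rw [key1, key2]; ring
  have hxt : ∀ x ∈ Ioo (0 : ℝ) L, ‖(L : ℂ)⁻¹ * x‖ ≤ 1 := fun x hx => by
    rw [norm_mul, hinv, Complex.norm_real, Real.norm_of_nonneg hx.1.le, inv_mul_le_iff₀ hL0,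
      mul_one]
    exact hx.2.le
  have b1 : ‖polyLp L P‖ ≤ 6 * √L := by
    refine norm_polyLp_le hL0.le _ (by norm_num) fun x hx => ?_
    have h1 : P.eval (x : ℂ) = 1 - 3 * ((L : ℂ)⁻¹ * x) ^ 2 + 2 * ((L : ℂ)⁻¹ * x) ^ 3 := by
      rw [hP, eval_hermiteCubic]; ring
    rw [h1]
    refine (norm_add_le _ _).trans ?_
    have h2 := norm_sub_le (1 : ℂ) (3 * ((L : ℂ)⁻¹ * x) ^ 2)
    rw [norm_mul, norm_pow, norm_one] at h2
    rw [norm_mul, norm_pow]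
    have h3 : ‖(L : ℂ)⁻¹ * x‖ ^ 2 ≤ 1 := pow_le_one₀ (norm_nonneg _) (hxt x hx)
    have h4 : ‖(L : ℂ)⁻¹ * x‖ ^ 3 ≤ 1 := pow_le_one₀ (norm_nonneg _) (hxt x hx)
    have h5 : ‖(3 : ℂ)‖ = 3 := by simp
    have h6 : ‖(2 : ℂ)‖ = 2 := by simp
    rw [h5] at h2
    rw [h6]
    linarith
  have b2 : ‖polyLp L (-derivative (derivative P))‖ ≤ (18 * lmin⁻¹ ^ 2) * √L := by
    refine norm_polyLp_le hL0.le _ (by positivity) fun x hx => ?_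
    have h1 : (-derivative (derivative P)).eval (x : ℂ)
        = (L : ℂ)⁻¹ ^ 2 * (6 - 12 * ((L : ℂ)⁻¹ * x)) := by
      rw [eval_neg, hP, derivative_derivative_hermiteCubic]
      simp only [eval_add, eval_C, eval_mul, eval_X]
      ring
    rw [h1, norm_mul, norm_pow, hinv]
    have h2 := norm_sub_le (6 : ℂ) (12 * ((L : ℂ)⁻¹ * x))
    rw [norm_mul] at h2
    have h3 := hxt x hx
    have h5 : ‖(6 : ℂ)‖ = 6 := by simp
    have h6 : ‖(12 : ℂ)‖ = 12 := by simp
    rw [h5, h6] at h2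
    have h7 : ‖(6 : ℂ) - 12 * ((L : ℂ)⁻¹ * x)‖ ≤ 18 := by linarith
    have h8 : L⁻¹ ^ 2 ≤ lmin⁻¹ ^ 2 := by gcongr
    calc L⁻¹ ^ 2 * ‖(6 : ℂ) - 12 * ((L : ℂ)⁻¹ * x)‖ ≤ lmin⁻¹ ^ 2 * 18 := by gcongr
      _ = _ := by ring
  have b3 : ‖u' 0‖ ≤ (6 * √L) * ‖h‖ + ((18 * lmin⁻¹ ^ 2) * √L) * ‖f‖ := by
    rw [← RCLike.norm_conj (K := ℂ), hu0]
    refine (norm_sub_le _ _).trans (add_le_add ?_ ?_)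
    · refine (norm_inner_le_norm _ _).trans ?_
      rw [mul_comm]; gcongr
    · refine (norm_inner_le_norm _ _).trans ?_
      rw [mul_comm]; gcongr
  have b4 : ∀ x ∈ Ioo (0 : ℝ) L,
      ‖u' x‖ ≤ (7 * S) * ‖h‖ + ((18 * lmin⁻¹ ^ 2) * S) * ‖f‖ := by
    intro x hx
    rw [hf.deriv'.eq_primitive hL0 hf.rep' (Ioo_subset_Icc_self hx)]
    have h1 : ‖∫ t in (0 : ℝ)..x, (-h : L2Interval L) t‖ ≤ √L * ‖h‖ := by
      rw [← norm_neg h]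
      refine le_trans ?_ ((-h).integral_norm_le hL0)
      rw [intervalIntegral.integral_of_le hx.1.le]
      refine (norm_integral_le_integral_norm _).trans ?_
      refine setIntegral_mono_set ?_ (Filter.Eventually.of_forall fun _ => norm_nonneg _)
        (LE.le.eventuallyLE fun t ht => ⟨ht.1, ht.2.trans_lt hx.2⟩)
      exact ((Lp.memLp (-h)).integrable (by norm_num)).norm
    refine (norm_add_le _ _).trans ((add_le_add b3 h1).trans ?_)
    have h2 : (6 * √L) * ‖h‖ + ((18 * lmin⁻¹ ^ 2) * √L) * ‖f‖ + √L * ‖h‖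
        = (7 * √L) * ‖h‖ + ((18 * lmin⁻¹ ^ 2) * √L) * ‖f‖ := by ring
    rw [h2]
    gcongr
  have b5 : ‖f'‖ ≤ K₁ * (‖f‖ + ‖h‖) := by
    have h1 : ‖f'‖ ≤ ((7 * S) * ‖h‖ + ((18 * lmin⁻¹ ^ 2) * S) * ‖f‖) * √L := by
      refine norm_le_sqrt_mul_of_ae_bound hL0.le f' (by positivity) ?_
      filter_upwards [hf.rep'.2, self_mem_ae_restrict measurableSet_Ioo] with x h1 h2
      rw [h1]
      exact b4 x h2
    refine h1.trans ?_
    have h2 : ((7 * S) * ‖h‖ + ((18 * lmin⁻¹ ^ 2) * S) * ‖f‖) * √L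
        ≤ ((7 * S) * ‖h‖ + ((18 * lmin⁻¹ ^ 2) * S) * ‖f‖) * S := by gcongr
    refine h2.trans ?_
    have h3 : 0 ≤ 7 * S * S * ‖f‖ := by positivity
    have h4 : 0 ≤ (18 * lmin⁻¹ ^ 2) * S * S * ‖h‖ := by positivity
    rw [hK₁]
    linarith
  calc ‖f'‖ ^ 2 ≤ (K₁ * (‖f‖ + ‖h‖)) ^ 2 := by gcongr
    _ = K₁ ^ 2 * (‖f‖ + ‖h‖) ^ 2 := by ring
    _ ≤ K₁ ^ 2 * (2 * (‖f‖ ^ 2 + ‖h‖ ^ 2)) := by gcongr; exact add_sq_le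
    _ = _ := by ring

end Interval

/-! ### Summation over a tree -/

section Tree

open Polynomial Filter Topology
open scoped InnerProductSpace

instance TreeVertex.fintype (b : ℕ → ℕ) : ∀ n, Fintype (TreeVertex b n)
  | 0 => inferInstanceAs (Fintype Unit)
  | n + 1 =>
    letI := TreeVertex.fintype b n
    inferInstanceAs (Fintype (TreeVertex b n × Fin (branching b n)))

variable {b : ℕ → ℕ} {ℓ q : ℕ → ℝ}

theorem TreeVertex.sum_succ {E : Type*} [AddCommMonoid E] {n : ℕ} (F : TreeVertex b (n + 1) → E) :
    ∑ w, F w = ∑ v : TreeVertex b n, ∑ j, F (v.child j) :=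
  Fintype.sum_prod_type (f := F)

theorem TreeVertex.child_inj {n : ℕ} {v w : TreeVertex b n} {i j : Fin (branching b n)} :
    v.child i = w.child j ↔ v = w ∧ i = j :=
  Prod.mk_inj

/-- A sum over all edges is the limit of the sums over finitely many generations. -/
theorem HasSum.tendsto_generations {E : Type*} [AddCommGroup E] [TopologicalSpace E]
    [IsTopologicalAddGroup E] {F : TreeEdge b → E} {S : E} (h : HasSum F S) :
    Tendsto (fun N => ∑ n ∈ Finset.range N, ∑ v : TreeVertex b (n + 1), F ⟨n, v⟩) atTop (𝓝 S) :=
  (h.sigma fun n => hasSum_fintype (fun v : TreeVertex b (n + 1) => F ⟨n, v⟩)).tendsto_sum_nat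

theorem HasSum.tendsto_generation_zero {F : TreeEdge b → ℝ} {S : ℝ} (h : HasSum F S) :
    Tendsto (fun n => ∑ v : TreeVertex b (n + 1), F ⟨n, v⟩) atTop (𝓝 0) :=
  (h.sigma fun n =>
    hasSum_fintype (fun v : TreeVertex b (n + 1) => F ⟨n, v⟩)).summable.tendsto_atTop_zero

theorem L2Tree.hasSum_norm_sq (f : L2Tree b ℓ) : HasSum (fun e => ‖f e‖ ^ 2) (‖f‖ ^ 2) := by
  have h := lp.hasSum_inner (𝕜 := ℂ) f f
  simp only [inner_self_eq_norm_sq_to_K] at h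
  exact_mod_cast h

/-- `IsH2` on all edges together with the vertex conditions. -/
theorem isTreeLaplacian_iff {f h : L2Tree b ℓ} : IsTreeLaplacian b ℓ q f h ↔
    ∃ (f' : L2Tree b ℓ) (u u' : TreeEdge b → ℝ → ℂ),
      (∀ e, IsH2 (f e) (f' e) (h e) (u e) (u' e)) ∧ VertexConditions b ℓ q u u' := by
  constructor
  · rintro ⟨f', u, u', h1, h2, h3, h4, h5⟩
    exact ⟨f', u, u', fun e => ⟨h1 e, h2 e, h3 e, h4 e⟩, h5⟩
  · rintro ⟨f', u, u', h1, h5⟩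
    exact ⟨f', u, u', fun e => (h1 e).deriv, fun e => (h1 e).deriv', fun e => (h1 e).rep,
      fun e => (h1 e).rep', h5⟩

/-- Telescoping over generations: `s n` and `t n` will be boundary terms at the near and far ends of
the edges, and `x n` what the vertex conditions contribute between them. Only `N` vertex terms occur
between `N + 1` generations of edges. -/
theorem sum_range_sub_of_step {E : Type*} [AddCommGroup E] {s t x : ℕ → E}
    (h : ∀ n, s (n + 1) = t n + x n) (N : ℕ) :
    ∑ n ∈ Finset.range (N + 1), (s n - t n) = s 0 + ∑ n ∈ Finset.range N, x n - t N := by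
  induction N with
  | zero => simp
  | succ N ih =>
    rw [Finset.sum_range_succ, ih, h, Finset.sum_range_succ]
    abel

/-- Uniform bounds for the edge lengths and the coupling constants. -/
structure BoundedParams (ℓ q : ℕ → ℝ) (lmin lmax Q : ℝ) : Prop where
  pos : 0 < lmin
  length : ∀ n, ℓ n ∈ Icc lmin lmax
  coupling : ∀ n, |q n| ≤ Q

variable {lmin lmax Q : ℝ}

theorem BoundedParams.length_pos (hp : BoundedParams ℓ q lmin lmax Q) (n : ℕ) : 0 < ℓ n :=
  hp.pos.trans_le (hp.length n).1

/-- By the trace inequality, uniform over the edges, the boundary values of a generation are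
dominated by the terms of a convergent series. This disposes of the boundary terms at infinity in
Green's formula. -/
theorem tendsto_sum_trace_sq (hp : BoundedParams ℓ q lmin lmax Q) {f f' : L2Tree b ℓ}
    {u : TreeEdge b → ℝ → ℂ} (hf : ∀ e, HasWeakDeriv (f e) (f' e))
    (hu : ∀ e, IsContinuousRep (f e) (u e)) :
    Tendsto (fun n => ∑ v : TreeVertex b (n + 1), ‖u ⟨n, v⟩ (ℓ n)‖ ^ 2) atTop (𝓝 0) := by
  obtain ⟨K, hK, H⟩ := exists_trace_bound (lmax := lmax) hp.pos one_pos
  have h1 := ((f'.hasSum_norm_sq.mul_left 1).add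
    (f.hasSum_norm_sq.mul_left K)).tendsto_generation_zero
  refine squeeze_zero (fun n => by positivity) (fun n => Finset.sum_le_sum fun v _ => ?_) h1
  exact H (ℓ n) (hp.length n) (f ⟨n, v⟩) (f' ⟨n, v⟩) (u ⟨n, v⟩) (hf ⟨n, v⟩) (hu ⟨n, v⟩)

theorem tendsto_sum_conj_mul {u w : TreeEdge b → ℝ → ℂ}
    (hu : Tendsto (fun n => ∑ v : TreeVertex b (n + 1), ‖u ⟨n, v⟩ (ℓ n)‖ ^ 2) atTop (𝓝 0))
    (hw : Tendsto (fun n => ∑ v : TreeVertex b (n + 1), ‖w ⟨n, v⟩ (ℓ n)‖ ^ 2) atTop (𝓝 0)) :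
    Tendsto (fun n => ∑ v : TreeVertex b (n + 1),
      (starRingEnd ℂ) (u ⟨n, v⟩ (ℓ n)) * w ⟨n, v⟩ (ℓ n)) atTop (𝓝 0) := by
  have h1 := hu.add hw
  rw [add_zero] at h1
  refine squeeze_zero_norm (fun n => ?_) h1
  rw [← Finset.sum_add_distrib]
  refine (norm_sum_le _ _).trans (Finset.sum_le_sum fun v _ => ?_)
  rw [norm_mul, RCLike.norm_conj]
  nlinarith [sq_nonneg (‖u ⟨n, v⟩ (ℓ n)‖ - ‖w ⟨n, v⟩ (ℓ n)‖),
    sq_nonneg ‖u ⟨n, v⟩ (ℓ n)‖, sq_nonneg ‖w ⟨n, v⟩ (ℓ n)‖]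

theorem VertexConditions.sum_deriv {u u' : TreeEdge b → ℝ → ℂ} (h : VertexConditions b ℓ q u u')
    (n : ℕ) (v : TreeVertex b (n + 1)) :
    ∑ j, u' ⟨n + 1, v.child j⟩ 0 = u' ⟨n, v⟩ (ℓ n) + q n * u ⟨n, v⟩ (ℓ n) := by
  linear_combination h.kirchhoff n v

/-- `ℍ(b, ℓ, q)` is symmetric. -/
theorem IsTreeLaplacian.symm (hp : BoundedParams ℓ q lmin lmax Q) {f h g k : L2Tree b ℓ}
    (hf : IsTreeLaplacian b ℓ q f h) (hg : IsTreeLaplacian b ℓ q g k) :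
    ⟪h, g⟫_ℂ = ⟪f, k⟫_ℂ := by
  obtain ⟨f', u, u', hu, hvu⟩ := isTreeLaplacian_iff.mp hf
  obtain ⟨g', w, w', hw, hvw⟩ := isTreeLaplacian_iff.mp hg
  have h1 := ((lp.hasSum_inner (𝕜 := ℂ) h g).sub (lp.hasSum_inner (𝕜 := ℂ) f k)).tendsto_generations
  set t : ℕ → ℂ := fun n => ∑ v : TreeVertex b (n + 1),
    ((starRingEnd ℂ) (u ⟨n, v⟩ (ℓ n)) * w' ⟨n, v⟩ (ℓ n)
      - (starRingEnd ℂ) (u' ⟨n, v⟩ (ℓ n)) * w ⟨n, v⟩ (ℓ n)) with ht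
  set s : ℕ → ℂ := fun n => ∑ v : TreeVertex b (n + 1),
    ((starRingEnd ℂ) (u ⟨n, v⟩ 0) * w' ⟨n, v⟩ 0
      - (starRingEnd ℂ) (u' ⟨n, v⟩ 0) * w ⟨n, v⟩ 0) with hs
  -- The Wronskian flux is conserved at each vertex: by continuity and the Kirchhoff condition the
  -- two coupling terms cancel, the coupling being real.
  have hst : ∀ n, s (n + 1) = t n + 0 := by
    intro n
    simp only [hs, ht]
    rw [add_zero, TreeVertex.sum_succ]
    refine Finset.sum_congr rfl fun v _ => ?_
    simp only [hvu.continuity, hvw.continuity]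
    rw [Finset.sum_sub_distrib, ← Finset.mul_sum, ← Finset.sum_mul, ← map_sum, hvu.sum_deriv,
      hvw.sum_deriv, map_add, map_mul, Complex.conj_ofReal]
    ring
  have hs0 : s 0 = 0 := Finset.sum_eq_zero fun v _ => by
    rw [hvu.dirichlet, hvw.dirichlet, map_zero]; ring
  have h2 : ∀ N, ∑ n ∈ Finset.range (N + 1), ∑ v : TreeVertex b (n + 1),
      (⟪h ⟨n, v⟩, g ⟨n, v⟩⟫_ℂ - ⟪f ⟨n, v⟩, k ⟨n, v⟩⟫_ℂ) = t N := by
    intro N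
    have h3 := sum_range_sub_of_step hst N
    rw [hs0, Finset.sum_const_zero, add_zero, zero_sub] at h3
    rw [← neg_neg (t N), ← h3, ← Finset.sum_neg_distrib]
    refine Finset.sum_congr rfl fun n _ => ?_
    simp only [hs, ht]
    rw [← Finset.sum_sub_distrib, ← Finset.sum_neg_distrib]
    refine Finset.sum_congr rfl fun v _ => ?_
    rw [(hu ⟨n, v⟩).inner_left (hp.length_pos n) (hw ⟨n, v⟩),
      (hu ⟨n, v⟩).inner_right (hp.length_pos n) (hw ⟨n, v⟩)]
    ring
  have h4 : Tendsto t atTop (𝓝 0) := by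
    have tu := tendsto_sum_trace_sq hp (fun e => (hu e).deriv) (fun e => (hu e).rep)
    have tu' := tendsto_sum_trace_sq hp (f := f') (f' := -h) (fun e => (hu e).deriv')
      (fun e => (hu e).rep')
    have tw := tendsto_sum_trace_sq hp (fun e => (hw e).deriv) (fun e => (hw e).rep)
    have tw' := tendsto_sum_trace_sq hp (f := g') (f' := -k) (fun e => (hw e).deriv')
      (fun e => (hw e).rep')
    have := (tendsto_sum_conj_mul tu tw').sub (tendsto_sum_conj_mul tu' tw)
    simpa only [← Finset.sum_sub_distrib, sub_zero] using this
  have h5 := (tendsto_add_atTop_iff_nat 1).mpr h1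
  simp only [h2] at h5
  exact sub_eq_zero.mp (tendsto_nhds_unique h5 h4)

/-- `ℍ(b, ℓ, q)` is bounded below, uniformly in the parameters. -/
theorem exists_lower_bound (hmin : 0 < lmin) (hQ : 0 ≤ Q) :
    ∃ c : ℝ, ∀ {b : ℕ → ℕ} {ℓ q : ℕ → ℝ}, BoundedParams ℓ q lmin lmax Q → ∀ {f h : L2Tree b ℓ},
      IsTreeLaplacian b ℓ q f h → ‖f‖ ^ 2 ≤ (⟪f, h + (c : ℂ) • f⟫_ℂ).re := by
  -- With `η = (Q + 1)⁻¹` one has `Q η ≤ 1`, so a negative coupling term is absorbed by `‖f'‖ ^ 2 +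
  -- Q K ‖f‖ ^ 2` on the edge ending at the vertex. The summand `1` in the shift yields the bound by
  -- `‖f‖ ^ 2`.
  obtain ⟨K, hK, H⟩ := exists_trace_bound (lmax := lmax) hmin (η := (Q + 1)⁻¹) (by positivity)
  refine ⟨1 + Q * K, fun {b ℓ q} hp f h hf => ?_⟩
  obtain ⟨f', u, u', hu, hvu⟩ := isTreeLaplacian_iff.mp hf
  set t : ℕ → ℂ := fun n => ∑ v : TreeVertex b (n + 1),
    (starRingEnd ℂ) (u ⟨n, v⟩ (ℓ n)) * u' ⟨n, v⟩ (ℓ n) with ht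
  set s : ℕ → ℂ := fun n => ∑ v : TreeVertex b (n + 1),
    (starRingEnd ℂ) (u ⟨n, v⟩ 0) * u' ⟨n, v⟩ 0 with hs
  set x : ℕ → ℝ := fun n => q n * ∑ v : TreeVertex b (n + 1), ‖u ⟨n, v⟩ (ℓ n)‖ ^ 2 with hx
  set a : ℕ → ℝ := fun n => ∑ v : TreeVertex b (n + 1),
    (‖f' ⟨n, v⟩‖ ^ 2 + Q * K * ‖f ⟨n, v⟩‖ ^ 2) with ha
  have hst : ∀ n, s (n + 1) = t n + (x n : ℂ) := by
    intro n
    simp only [hs, ht, hx]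
    rw [TreeVertex.sum_succ]
    push_cast
    rw [Finset.mul_sum, ← Finset.sum_add_distrib]
    refine Finset.sum_congr rfl fun v _ => ?_
    simp only [hvu.continuity]
    rw [← Finset.mul_sum, hvu.sum_deriv, ← Complex.conj_mul']
    ring
  have hs0 : s 0 = 0 := Finset.sum_eq_zero fun v _ => by
    rw [hvu.dirichlet, map_zero]; ring
  have hax : ∀ n, 0 ≤ a n + x n := by
    intro n
    simp only [ha, hx]
    rw [Finset.mul_sum, ← Finset.sum_add_distrib]
    refine Finset.sum_nonneg fun v _ => ?_
    have h1 := H (ℓ n) (hp.length n) (f ⟨n, v⟩) (f' ⟨n, v⟩) (u ⟨n, v⟩) (hu ⟨n, v⟩).deriv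
      (hu ⟨n, v⟩).rep
    have h2 := neg_le_of_abs_le (hp.coupling n)
    have h3 : -Q * ‖u ⟨n, v⟩ (ℓ n)‖ ^ 2 ≤ q n * ‖u ⟨n, v⟩ (ℓ n)‖ ^ 2 := by gcongr
    have h4 : Q * ‖u ⟨n, v⟩ (ℓ n)‖ ^ 2
        ≤ Q * ((Q + 1)⁻¹ * ‖f' ⟨n, v⟩‖ ^ 2 + K * ‖f ⟨n, v⟩‖ ^ 2) := by gcongr
    have h5 : Q * (Q + 1)⁻¹ ≤ 1 := by
      rw [← div_eq_mul_inv, div_le_one (by positivity)]; linarith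
    have h6 : Q * (Q + 1)⁻¹ * ‖f' ⟨n, v⟩‖ ^ 2 ≤ 1 * ‖f' ⟨n, v⟩‖ ^ 2 := by gcongr
    linarith
  have ha0 : ∀ n, 0 ≤ a n := fun n => Finset.sum_nonneg fun v _ => by positivity
  have h1 := (((lp.hasSum_inner (𝕜 := ℂ) f h).mapL Complex.reCLM).add
    (f.hasSum_norm_sq.mul_left (Q * K))).tendsto_generations
  -- Each vertex term `x n` is paired with the energy `a n` of the edges above it; the last
  -- generation keeps `a N ≥ 0` unpaired, and `t N` tends to zero.
  have h2 : ∀ N, ∑ n ∈ Finset.range (N + 1), ∑ v : TreeVertex b (n + 1),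
      (Complex.reCLM ⟪f ⟨n, v⟩, h ⟨n, v⟩⟫_ℂ + Q * K * ‖f ⟨n, v⟩‖ ^ 2)
      = ∑ n ∈ Finset.range N, (a n + x n) + a N - (t N).re := by
    intro N
    have h3 := congrArg Complex.re (sum_range_sub_of_step hst N)
    rw [hs0, zero_add, ← Complex.ofReal_sum, Complex.sub_re, Complex.ofReal_re,
      Complex.re_sum] at h3
    have h4 : ∀ n, ∑ v : TreeVertex b (n + 1),
        (Complex.reCLM ⟪f ⟨n, v⟩, h ⟨n, v⟩⟫_ℂ + Q * K * ‖f ⟨n, v⟩‖ ^ 2)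
        = a n + (s n - t n).re := by
      intro n
      simp only [ha, hs, ht]
      rw [← Finset.sum_sub_distrib, Complex.re_sum, ← Finset.sum_add_distrib]
      refine Finset.sum_congr rfl fun v _ => ?_
      rw [(hu ⟨n, v⟩).inner_right (hp.length_pos n) (hu ⟨n, v⟩), inner_self_eq_norm_sq_to_K]
      simp only [Complex.reCLM_apply, Complex.sub_re, Complex.coe_algebraMap, ← Complex.ofReal_pow,
        Complex.ofReal_re]
      ring
    rw [Finset.sum_congr rfl fun n _ => h4 n, Finset.sum_add_distrib, h3, Finset.sum_range_succ,
      Finset.sum_add_distrib]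
    ring
  have h5 : Tendsto t atTop (𝓝 0) := by
    have tu := tendsto_sum_trace_sq hp (fun e => (hu e).deriv) (fun e => (hu e).rep)
    have tu' := tendsto_sum_trace_sq hp (f := f') (f' := -h) (fun e => (hu e).deriv')
      (fun e => (hu e).rep')
    exact tendsto_sum_conj_mul tu tu'
  have h6 := ((tendsto_add_atTop_iff_nat 1).mpr h1).add
    ((Complex.continuous_re.tendsto 0).comp h5)
  simp only [h2, Function.comp_apply, sub_add_cancel, Complex.zero_re, add_zero] at h6
  have h7 := ge_of_tendsto' h6 fun N =>
    add_nonneg (Finset.sum_nonneg fun n _ => hax n) (ha0 N)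
  rw [inner_add_right, inner_smul_right, inner_self_eq_norm_sq_to_K, Complex.add_re]
  have h8 : (((1 + Q * K : ℝ) : ℂ) * ((‖f‖ : ℝ) : ℂ) ^ 2).re = (1 + Q * K) * ‖f‖ ^ 2 := by
    rw [← Complex.ofReal_pow, ← Complex.ofReal_mul, Complex.ofReal_re]
  have h9 : ((RCLike.ofReal ‖f‖ : ℂ)) = ((‖f‖ : ℝ) : ℂ) := rfl
  rw [h9, h8]
  rw [Complex.reCLM_apply] at h7
  linarith

/-! ### Piecewise polynomial functions -/

/-- Piecewise polynomial functions that vanish on all but finitely many edges and satisfy the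
vertex conditions. -/
def polyCore (b : ℕ → ℕ) (ℓ q : ℕ → ℝ) : Submodule ℂ (TreeEdge b → ℂ[X]) where
  carrier := {Φ | (∃ N, ∀ n, N ≤ n → ∀ v, Φ ⟨n, v⟩ = 0) ∧
    VertexConditions b ℓ q (fun e x => (Φ e).eval (x : ℂ))
      (fun e x => (derivative (Φ e)).eval (x : ℂ))}
  zero_mem' := ⟨⟨0, fun _ _ _ => rfl⟩, by constructor <;> intros <;> simp⟩
  add_mem' := by
    rintro Φ Ψ ⟨⟨N, hN⟩, h⟩ ⟨⟨M, hM⟩, k⟩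
    refine ⟨⟨max N M, fun n hn v => ?_⟩, ⟨fun v => ?_, fun n v j => ?_, fun n v => ?_⟩⟩
    · rw [Pi.add_apply, hN n ((le_max_left _ _).trans hn), hM n ((le_max_right _ _).trans hn),
        add_zero]
    · simp only [Pi.add_apply, eval_add, h.dirichlet, k.dirichlet, add_zero]
    · simp only [Pi.add_apply, eval_add, h.continuity, k.continuity]
    · simp only [Pi.add_apply, eval_add, derivative_add, Finset.sum_add_distrib]
      linear_combination h.kirchhoff n v + k.kirchhoff n v
  smul_mem' := by
    rintro c Φ ⟨⟨N, hN⟩, h⟩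
    refine ⟨⟨N, fun n hn v => ?_⟩, ⟨fun v => ?_, fun n v j => ?_, fun n v => ?_⟩⟩
    · rw [Pi.smul_apply, hN n hn, smul_zero]
    · simp only [Pi.smul_apply, eval_smul, h.dirichlet, smul_zero]
    · simp only [Pi.smul_apply, eval_smul, h.continuity]
    · simp only [Pi.smul_apply, eval_smul, derivative_smul, smul_eq_mul, ← Finset.mul_sum]
      linear_combination c * h.kirchhoff n v

theorem finite_generation_lt (b : ℕ → ℕ) (N : ℕ) : {e : TreeEdge b | e.1 < N}.Finite := by
  refine ((Finset.range N).sigma fun n =>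
    (Finset.univ : Finset (TreeVertex b (n + 1)))).finite_toSet.subset fun e he => ?_
  simpa using he

theorem memℓp_of_generation {F : ∀ e : TreeEdge b, L2Interval (ℓ e.1)} {N : ℕ}
    (h : ∀ n, N ≤ n → ∀ v, F ⟨n, v⟩ = 0) : Memℓp F 2 := by
  refine (memℓp_zero ?_).of_exponent_ge zero_le
  refine (finite_generation_lt b N).subset fun e he => ?_
  by_contra hlt
  exact he (h e.1 (not_lt.mp hlt) e.2)

/-- The image in `L²(Γ)` of a piecewise polynomial function under a linear operation on
polynomials. -/
def polyTree (D : ℂ[X] →ₗ[ℂ] ℂ[X]) : polyCore b ℓ q →ₗ[ℂ] L2Tree b ℓ where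
  toFun Φ := ⟨fun e => polyLp (ℓ e.1) (D (Φ.1 e)), by
    obtain ⟨N, hN⟩ := Φ.2.1
    exact memℓp_of_generation (N := N) fun n hn v => by rw [hN n hn, map_zero, map_zero]⟩
  map_add' Φ Ψ := by
    ext1
    funext e
    change polyLp _ (D (Φ.1 e + Ψ.1 e)) = polyLp _ (D (Φ.1 e)) + polyLp _ (D (Ψ.1 e))
    rw [map_add, map_add]
  map_smul' c Φ := by
    ext1
    funext e
    change polyLp _ (D (c • Φ.1 e)) = c • polyLp _ (D (Φ.1 e))
    rw [map_smul, map_smul]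

/-- The second derivative with a minus sign. -/
def negSecondDeriv : ℂ[X] →ₗ[ℂ] ℂ[X] := -(derivative.comp derivative)

theorem negSecondDeriv_apply (P : ℂ[X]) : negSecondDeriv P = -derivative (derivative P) := rfl

theorem isTreeLaplacian_polyTree (hℓ : ∀ n, 0 < ℓ n) (Φ : polyCore b ℓ q) :
    IsTreeLaplacian b ℓ q (polyTree LinearMap.id Φ) (polyTree negSecondDeriv Φ) :=
  isTreeLaplacian_iff.mpr ⟨polyTree derivative Φ, _, _,
    fun e => isH2_polyLp (hℓ e.1).le (Φ.1 e), Φ.2.2⟩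

end Tree

/-! ### Test functions in the core and the adjoint of the restriction -/

section Tree

open Polynomial Filter Topology
open scoped InnerProductSpace

variable {b : ℕ → ℕ} {ℓ q : ℕ → ℝ} {lmin lmax Q : ℝ}

-- Vanishing boundary data make all vertex conditions trivial. On the edge at the root the
-- derivative at `0` is free, because only the Dirichlet condition is imposed there.
open Classical in
theorem single_mem_polyCore (e : TreeEdge b) {P : ℂ[X]} (h0 : P.eval 0 = 0)
    (h1 : P.eval (ℓ e.1 : ℂ) = 0) (h2 : e.1 = 0 ∨ (derivative P).eval 0 = 0)
    (h3 : (derivative P).eval (ℓ e.1 : ℂ) = 0) : Pi.single e P ∈ polyCore b ℓ q := by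
  have z0 : ∀ e', ((Pi.single e P : TreeEdge b → ℂ[X]) e').eval 0 = 0 := fun e' => by
    rw [Pi.single_apply]; split_ifs with he
    · exact h0
    · simp
  have z1 : ∀ e', ((Pi.single e P : TreeEdge b → ℂ[X]) e').eval (ℓ e'.1 : ℂ) = 0 := fun e' => by
    rw [Pi.single_apply]; split_ifs with he
    · rw [he, h1]
    · simp
  have z2 : ∀ n v, (derivative ((Pi.single e P : TreeEdge b → ℂ[X]) ⟨n + 1, v⟩)).eval 0 = 0 :=
    fun n v => by
      rw [Pi.single_apply]; split_ifs with he
      · refine h2.resolve_left ?_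
        rw [← he]; exact n.succ_ne_zero
      · simp
  have z3 : ∀ e', (derivative ((Pi.single e P : TreeEdge b → ℂ[X]) e')).eval (ℓ e'.1 : ℂ) = 0 :=
    fun e' => by
      rw [Pi.single_apply]; split_ifs with he
      · rw [he, h3]
      · simp
  refine ⟨⟨e.1 + 1, fun n hn v => ?_⟩, ⟨fun v => ?_, fun n v j => ?_, fun n v => ?_⟩⟩
  · rw [Pi.single_apply, if_neg]
    rintro rfl
    exact absurd hn (by simp)
  · simp only [Complex.ofReal_zero]
    exact z0 _
  · simp only [Complex.ofReal_zero]
    exact (z0 _).trans (z1 ⟨n, v⟩).symm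
  · simp only [Complex.ofReal_zero]
    rw [Finset.sum_eq_zero fun j _ => z2 n _, z3 ⟨n, v⟩, z1 ⟨n, v⟩]
    ring

open Classical in
/-- A function in the polynomial core supported on the edges adjacent to a single vertex, with
prescribed values at this vertex. -/
def starFunction (ℓ : ℕ → ℝ) (n : ℕ) (v : TreeVertex b (n + 1)) (a β : ℂ)
    (γ : Fin (branching b (n + 1)) → ℂ) : TreeEdge b → ℂ[X] :=
  Pi.single ⟨n, v⟩ (hermiteCubic (ℓ n) 0 0 a β)
    + ∑ j, Pi.single ⟨n + 1, v.child j⟩ (hermiteCubic (ℓ (n + 1)) a (γ j) 0 0)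

/-- The hypothesis is the Kirchhoff condition at `v`; continuity there is built in through the
common value `a`, and all data at the other vertices vanish. Evaluation of the function or of its
derivative at an end is abstracted as a linear functional `D`, so that both are computed at once. -/
theorem starFunction_mem_polyCore (hℓ : ∀ n, 0 < ℓ n) (n : ℕ) (v : TreeVertex b (n + 1)) {a β : ℂ}
    {γ : Fin (branching b (n + 1)) → ℂ} (h : ∑ j, γ j - β = q n * a) :
    starFunction ℓ n v a β γ ∈ polyCore b ℓ q := by
  classical
  have hne : ∀ n, ℓ n ≠ 0 := fun n => (hℓ n).ne'
  have happ : ∀ e, starFunction ℓ n v a β γ e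
      = (if e = ⟨n, v⟩ then hermiteCubic (ℓ n) 0 0 a β else 0)
        + ∑ j, if e = ⟨n + 1, v.child j⟩ then hermiteCubic (ℓ (n + 1)) a (γ j) 0 0 else 0 := by
    intro e
    simp only [starFunction, Pi.add_apply, Finset.sum_apply, Pi.single_apply]
  -- boundary values at the two ends of the edges
  have left : ∀ (D : ℂ[X] →ₗ[ℂ] ℂ) (δ : Fin (branching b (n + 1)) → ℂ),
      D (hermiteCubic (ℓ n) 0 0 a β) = 0 →
      (∀ j, D (hermiteCubic (ℓ (n + 1)) a (γ j) 0 0) = δ j) → ∀ e,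
      D (starFunction ℓ n v a β γ e) = ∑ j, if e = ⟨n + 1, v.child j⟩ then δ j else 0 := by
    intro D δ h0 h1 e
    rw [happ, map_add, map_sum, apply_ite D, h0, map_zero, ite_self, zero_add]
    exact Finset.sum_congr rfl fun j _ => by rw [apply_ite D, h1, map_zero]
  have left' : ∀ (D : ℂ[X] →ₗ[ℂ] ℂ) (δ : Fin (branching b (n + 1)) → ℂ),
      D (hermiteCubic (ℓ n) 0 0 a β) = 0 →
      (∀ j, D (hermiteCubic (ℓ (n + 1)) a (γ j) 0 0) = δ j) →
      ∀ (m : ℕ) (w : TreeVertex b (m + 1)), (⟨m, w⟩ : TreeEdge b) ≠ ⟨n, v⟩ → ∀ j,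
      D (starFunction ℓ n v a β γ ⟨m + 1, w.child j⟩) = 0 := by
    intro D δ h0 h1 m w hw j
    rw [left D δ h0 h1]
    refine Finset.sum_eq_zero fun i _ => if_neg fun heq => hw ?_
    obtain ⟨h2, h3⟩ := Sigma.mk.inj heq
    obtain rfl : m = n := Nat.succ_injective h2
    rw [(TreeVertex.child_inj.mp (eq_of_heq h3)).1]
  have left'' : ∀ (D : ℂ[X] →ₗ[ℂ] ℂ) (δ : Fin (branching b (n + 1)) → ℂ),
      D (hermiteCubic (ℓ n) 0 0 a β) = 0 →
      (∀ j, D (hermiteCubic (ℓ (n + 1)) a (γ j) 0 0) = δ j) → ∀ j,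
      D (starFunction ℓ n v a β γ ⟨n + 1, v.child j⟩) = δ j := by
    intro D δ h0 h1 j
    rw [left D δ h0 h1, Finset.sum_eq_single j]
    · rw [if_pos rfl]
    · intro i _ hij
      refine if_neg fun heq => hij ?_
      exact (TreeVertex.child_inj.mp (eq_of_heq (Sigma.mk.inj heq).2)).2.symm
    · simp
  have right : ∀ (D : ℕ → ℂ[X] →ₗ[ℂ] ℂ) (δ : ℂ), D n (hermiteCubic (ℓ n) 0 0 a β) = δ →
      (∀ j, D (n + 1) (hermiteCubic (ℓ (n + 1)) a (γ j) 0 0) = 0) → ∀ e : TreeEdge b,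
      D e.1 (starFunction ℓ n v a β γ e) = if e = ⟨n, v⟩ then δ else 0 := by
    intro D δ h0 h1 e
    rw [happ, map_add, map_sum, Finset.sum_eq_zero, add_zero]
    · split_ifs with he
      · rw [he]; exact h0
      · exact map_zero _
    · intro j _
      split_ifs with he
      · rw [he]; exact h1 j
      · exact map_zero _
  let ev : ℂ → ℂ[X] →ₗ[ℂ] ℂ := fun x => Polynomial.leval x
  have L0 := left' (ev 0) (fun _ => a) (eval_hermiteCubic_left _ _ _ _ _)
    (fun _ => eval_hermiteCubic_left _ _ _ _ _)
  have L0' := left'' (ev 0) (fun _ => a) (eval_hermiteCubic_left _ _ _ _ _)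
    (fun _ => eval_hermiteCubic_left _ _ _ _ _)
  have L1 := left' ((ev 0).comp derivative) γ (eval_derivative_hermiteCubic_left _ _ _ _ _)
    (fun _ => eval_derivative_hermiteCubic_left _ _ _ _ _)
  have L1' := left'' ((ev 0).comp derivative) γ (eval_derivative_hermiteCubic_left _ _ _ _ _)
    (fun _ => eval_derivative_hermiteCubic_left _ _ _ _ _)
  have R0 := right (fun m => ev (ℓ m)) a (eval_hermiteCubic_right (hne _) _ _ _ _)
    (fun _ => eval_hermiteCubic_right (hne _) _ _ _ _)
  have R1 := right (fun m => (ev (ℓ m)).comp derivative) β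
    (eval_derivative_hermiteCubic_right (hne _) _ _ _ _)
    (fun _ => eval_derivative_hermiteCubic_right (hne _) _ _ _ _)
  refine ⟨⟨n + 2, fun m hm w => ?_⟩, ⟨fun w => ?_, fun m w j => ?_, fun m w => ?_⟩⟩
  · rw [happ, if_neg, Finset.sum_eq_zero, add_zero]
    · intro j _
      refine if_neg fun heq => ?_
      have h2 : m = n + 1 := (Sigma.mk.inj heq).1
      omega
    · intro heq
      have h2 : m = n := (Sigma.mk.inj heq).1
      omega
  · have h2 := left (ev 0) (fun _ => a) (eval_hermiteCubic_left _ _ _ _ _)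
      (fun _ => eval_hermiteCubic_left _ _ _ _ _) ⟨0, w⟩
    rw [Finset.sum_eq_zero] at h2
    · simpa [ev] using h2
    · intro j _
      refine if_neg fun heq => ?_
      have h2 : 0 = n + 1 := (Sigma.mk.inj heq).1
      omega
  · have h2 := R0 ⟨m, w⟩
    simp only [Complex.ofReal_zero]
    by_cases hw : (⟨m, w⟩ : TreeEdge b) = ⟨n, v⟩
    · obtain ⟨rfl, h3⟩ := Sigma.mk.inj hw
      obtain rfl := eq_of_heq h3
      rw [if_pos rfl] at h2
      exact (L0' j).trans h2.symm
    · rw [if_neg hw] at h2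
      exact (L0 m w hw j).trans h2.symm
  · have h2 := R0 ⟨m, w⟩
    have h4 := R1 ⟨m, w⟩
    simp only [Complex.ofReal_zero]
    by_cases hw : (⟨m, w⟩ : TreeEdge b) = ⟨n, v⟩
    · obtain ⟨rfl, h3⟩ := Sigma.mk.inj hw
      obtain rfl := eq_of_heq h3
      rw [if_pos rfl] at h2 h4
      have h5 := Finset.sum_congr rfl fun j (_ : j ∈ Finset.univ) => L1' j
      change (starFunction ℓ m w a β γ ⟨m, w⟩).eval (ℓ m : ℂ) = a at h2
      change (derivative (starFunction ℓ m w a β γ ⟨m, w⟩)).eval (ℓ m : ℂ) = β at h4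
      change ∑ j, (derivative (starFunction ℓ m w a β γ ⟨m + 1, w.child j⟩)).eval 0 = _ at h5
      rw [h2, h4, h5, h]
    · rw [if_neg hw] at h2 h4
      have h5 := Finset.sum_eq_zero fun j (_ : j ∈ Finset.univ) => L1 m w hw j
      change (starFunction ℓ n v a β γ ⟨m, w⟩).eval (ℓ m : ℂ) = 0 at h2
      change (derivative (starFunction ℓ n v a β γ ⟨m, w⟩)).eval (ℓ m : ℂ) = 0 at h4
      change ∑ j, (derivative (starFunction ℓ n v a β γ ⟨m + 1, w.child j⟩)).eval 0 = _ at h5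
      rw [h2, h4, h5]
      ring

/-- The adjoint of the restriction of `ℍ(b, ℓ, q)` to the polynomial core is contained in
`ℍ(b, ℓ, q)`. -/
theorem isTreeLaplacian_of_inner_polyTree (hp : BoundedParams ℓ q lmin lmax Q) {f h : L2Tree b ℓ}
    (H : ∀ Φ : polyCore b ℓ q,
      ⟪h, polyTree LinearMap.id Φ⟫_ℂ = ⟪f, polyTree negSecondDeriv Φ⟫_ℂ) :
    IsTreeLaplacian b ℓ q f h := by
  classical
  have hℓ := hp.length_pos
  have hsum : ∀ Φ : polyCore b ℓ q, HasSum (fun e => ⟪f e, polyLp (ℓ e.1) (negSecondDeriv (Φ.1 e))⟫_ℂ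
      - ⟪h e, polyLp (ℓ e.1) (Φ.1 e)⟫_ℂ) 0 := by
    intro Φ
    have h1 := (lp.hasSum_inner (𝕜 := ℂ) f (polyTree negSecondDeriv Φ)).sub
      (lp.hasSum_inner (𝕜 := ℂ) h (polyTree LinearMap.id Φ))
    rw [H, sub_self] at h1
    exact h1
  have hsingle : ∀ (e₀ : TreeEdge b) (P : ℂ[X]),
      HasSum (fun e => ⟪f e, polyLp (ℓ e.1) (negSecondDeriv ((Pi.single e₀ P : TreeEdge b → ℂ[X]) e))⟫_ℂ
      - ⟪h e, polyLp (ℓ e.1) ((Pi.single e₀ P : TreeEdge b → ℂ[X]) e)⟫_ℂ)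
      (⟪f e₀, polyLp (ℓ e₀.1) (negSecondDeriv P)⟫_ℂ - ⟪h e₀, polyLp (ℓ e₀.1) P⟫_ℂ) := by
    intro e₀ P
    have h1 := hasSum_single (f := fun e => ⟪f e, polyLp (ℓ e.1)
      (negSecondDeriv ((Pi.single e₀ P : TreeEdge b → ℂ[X]) e))⟫_ℂ
      - ⟪h e, polyLp (ℓ e.1) ((Pi.single e₀ P : TreeEdge b → ℂ[X]) e)⟫_ℂ) e₀ (fun e he => by
        rw [Pi.single_eq_of_ne he, map_zero, map_zero, inner_zero_right, inner_zero_right, sub_self])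
    rwa [Pi.single_eq_same] at h1
  have hedge : ∀ e, ∃ f' u u', IsH2 (f e) f' (h e) u u' := by
    intro e
    -- Test functions supported on the single edge `e` give regularity there.
    refine IsH2.of_inner_polyLp (hℓ e.1) fun P h0 h1 h2 h3 => ?_
    have h4 := (hsingle e P).unique
      (hsum ⟨_, single_mem_polyCore e h0 h1 (Or.inr h2) h3⟩)
    exact (sub_eq_zero.mp h4).symm
  choose f' u u' hu using hedge
  -- The uniform bound makes the edgewise derivatives square summable, so they form an element of
  -- `L²(Γ)`.
  obtain ⟨K, hK, hder⟩ := exists_deriv_bound (lmax := lmax) hp.pos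
  have hmem : Memℓp f' 2 := by
    refine memℓp_gen ?_
    have h1 := (f.hasSum_norm_sq.add h.hasSum_norm_sq).summable.mul_left K
    refine h1.of_nonneg_of_le (fun e => by positivity) fun e => ?_
    have h2 := hder _ (hp.length e.1) _ _ _ _ _ (hu e)
    simpa using h2
  refine isTreeLaplacian_iff.mpr ⟨⟨f', hmem⟩, u, u', hu, ?_⟩
  have hgreen : ∀ (e : TreeEdge b) (P : ℂ[X]), ⟪f e, polyLp (ℓ e.1) (negSecondDeriv P)⟫_ℂ
      - ⟪h e, polyLp (ℓ e.1) P⟫_ℂ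
      = (starRingEnd ℂ) (u' e (ℓ e.1)) * P.eval (ℓ e.1 : ℂ)
        - (starRingEnd ℂ) (u e (ℓ e.1)) * (derivative P).eval (ℓ e.1 : ℂ)
        - ((starRingEnd ℂ) (u' e 0) * P.eval 0
          - (starRingEnd ℂ) (u e 0) * (derivative P).eval 0) := by
    intro e P
    have h1 := (hu e).inner_right (hℓ e.1) (isH2_polyLp (hℓ e.1).le P)
    have h2 := (hu e).inner_left (hℓ e.1) (isH2_polyLp (hℓ e.1).le P)
    rw [negSecondDeriv_apply, h1, h2, Complex.ofReal_zero]
    ring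
  -- Pairing with star functions gives a linear relation between the boundary values of `f` at `v`
  -- for all data `a`, `β`, `γ` satisfying the Kirchhoff condition.
  have hstar : ∀ (n : ℕ) (v : TreeVertex b (n + 1)) (a β : ℂ) (γ : Fin (branching b (n + 1)) → ℂ),
      ∑ j, γ j - β = q n * a →
      (starRingEnd ℂ) (u' ⟨n, v⟩ (ℓ n)) * a - (starRingEnd ℂ) (u ⟨n, v⟩ (ℓ n)) * β
      = ∑ j, ((starRingEnd ℂ) (u' ⟨n + 1, v.child j⟩ 0) * a
        - (starRingEnd ℂ) (u ⟨n + 1, v.child j⟩ 0) * γ j) := by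
    intro n v a β γ hγ
    have h1 := hsum ⟨_, starFunction_mem_polyCore hℓ n v hγ⟩
    have h2 := (hsingle ⟨n, v⟩ (hermiteCubic (ℓ n) 0 0 a β)).add
      (hasSum_sum fun j (_ : j ∈ Finset.univ) =>
        hsingle ⟨n + 1, v.child j⟩ (hermiteCubic (ℓ (n + 1)) a (γ j) 0 0))
    have h3 := HasSum.unique (Eq.mp (congrArg (fun F : TreeEdge b → ℂ => HasSum F 0)
      (funext fun e => ?_)) h1) h2
    · simp only [hgreen, eval_hermiteCubic_left, eval_derivative_hermiteCubic_left,
        eval_hermiteCubic_right (hℓ _).ne', eval_derivative_hermiteCubic_right (hℓ _).ne',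
        mul_zero, sub_zero, zero_sub, Finset.sum_neg_distrib] at h3
      linear_combination -h3
    · simp only [starFunction, Pi.add_apply, Finset.sum_apply, map_add, map_sum, inner_add_right,
        inner_sum, Finset.sum_sub_distrib]
      ring
  constructor
  · intro v
    -- The cubic whose only nonzero datum is the derivative at the root isolates `u` there.
    have h1 := (hsingle ⟨0, v⟩ (hermiteCubic (ℓ 0) 0 1 0 0)).unique
      (hsum ⟨_, single_mem_polyCore ⟨0, v⟩ (eval_hermiteCubic_left _ _ _ _ _)
        (eval_hermiteCubic_right (hℓ 0).ne' _ _ _ _) (Or.inl rfl)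
        (eval_derivative_hermiteCubic_right (hℓ 0).ne' _ _ _ _)⟩)
    rw [hgreen, eval_hermiteCubic_left, eval_derivative_hermiteCubic_left,
      eval_hermiteCubic_right (hℓ 0).ne', eval_derivative_hermiteCubic_right (hℓ 0).ne'] at h1
    simpa using h1
  · intro n v j
    -- Flux entering through the parent edge and leaving through the `j`-th child, with value zero
    -- at `v`, isolates continuity along that child.
    have h1 := hstar n v 0 1 (Pi.single j 1) (by simp)
    rw [Finset.sum_eq_single j (fun i _ hij => by rw [Pi.single_eq_of_ne hij]; ring) (by simp),
      Pi.single_eq_same] at h1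
    rw [mul_zero, mul_zero, mul_one, mul_one, zero_sub, zero_sub, neg_inj] at h1
    exact (starRingEnd ℂ).injective h1.symm
  · intro n v
    -- Value one at `v` with no outgoing flux isolates the Kirchhoff condition.
    have h1 := congrArg (starRingEnd ℂ) (hstar n v 1 (-q n) 0 (by simp))
    simp only [map_sub, map_mul, map_sum, Complex.conj_conj, map_neg, Pi.zero_apply,
      mul_zero, sub_zero, mul_one, Complex.conj_ofReal] at h1
    rw [← h1]
    ring

/-- `ℍ(b, ℓ, q)` is self-adjoint, bounded below, and has the polynomial core as a core. -/
theorem exists_isSemiboundedCore (hmin : 0 < lmin) (hQ : 0 ≤ Q) :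
    ∃ c : ℝ, ∀ {b : ℕ → ℕ} {ℓ q : ℕ → ℝ}, BoundedParams ℓ q lmin lmax Q →
      IsSemiboundedCore (treeLaplacian b ℓ q) (polyTree (b := b) (ℓ := ℓ) (q := q) LinearMap.id)
        (polyTree negSecondDeriv) c := by
  obtain ⟨c, hc⟩ := exists_lower_bound (lmax := lmax) hmin hQ
  refine ⟨c, fun {b ℓ q} hp => ⟨fun Φ => ?_, ?_, ?_, fun f h H => ?_⟩⟩
  · exact (treeLaplacian_graph b ℓ q _ _).mpr (isTreeLaplacian_polyTree hp.length_pos Φ)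
  · rintro ⟨f, h⟩ hf ⟨g, k⟩ hg
    exact ((treeLaplacian_graph b ℓ q _ _).mp hf).symm hp ((treeLaplacian_graph b ℓ q _ _).mp hg)
  · rintro ⟨f, h⟩ hf
    exact hc hp ((treeLaplacian_graph b ℓ q _ _).mp hf)
  · exact (treeLaplacian_graph b ℓ q _ _).mpr (isTreeLaplacian_of_inner_polyTree hp H)

end Tree

/-! ### Approximate eigenvalues -/

section Tree

open Polynomial Filter Topology

variable {b b' : ℕ → ℕ} {ℓ q : ℕ → ℝ}

/-- The polynomial core contains an approximate eigenfunction with relative error less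
than `ε`. -/
def IsApproxEigenvalue (b : ℕ → ℕ) (ℓ q : ℕ → ℝ) (z : ℂ) (ε : ℝ) : Prop :=
  ∃ Φ : polyCore b ℓ q, ‖polyTree negSecondDeriv Φ - z • polyTree LinearMap.id Φ‖
    < ε * ‖polyTree LinearMap.id Φ‖

/-- The square of the norm of a polynomial in `L²(0, L)`. -/
def polyEnergy (L : ℝ) (P : ℂ[X]) : ℝ := ∫ x in (0 : ℝ)..L, ‖P.eval (x : ℂ)‖ ^ 2

theorem polyEnergy_zero (L : ℝ) : polyEnergy L 0 = 0 := by simp [polyEnergy]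

theorem polyEnergy_smul (L : ℝ) (c : ℂ) (P : ℂ[X]) :
    polyEnergy L (c • P) = ‖c‖ ^ 2 * polyEnergy L P := by
  simp only [polyEnergy, eval_smul, norm_smul, mul_pow]
  exact intervalIntegral.integral_const_mul _ _

theorem norm_sq_polyTree (hℓ : ∀ n, 0 ≤ ℓ n) (D : ℂ[X] →ₗ[ℂ] ℂ[X]) (Φ : polyCore b ℓ q) {N : ℕ}
    (hN : ∀ n, N ≤ n → ∀ v, Φ.1 ⟨n, v⟩ = 0) : ‖polyTree D Φ‖ ^ 2
      = ∑ n ∈ Finset.range N, ∑ v : TreeVertex b (n + 1), polyEnergy (ℓ n) (D (Φ.1 ⟨n, v⟩)) := by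
  have h1 := (polyTree D Φ).hasSum_norm_sq.tendsto_generations
  refine tendsto_nhds_unique h1 (tendsto_const_nhds.congr' ?_)
  filter_upwards [eventually_ge_atTop N] with M hM
  have h2 : ∀ n, ∑ v : TreeVertex b (n + 1), ‖polyTree D Φ ⟨n, v⟩‖ ^ 2
      = ∑ v : TreeVertex b (n + 1), polyEnergy (ℓ n) (D (Φ.1 ⟨n, v⟩)) := fun n =>
    Finset.sum_congr rfl fun v _ => norm_sq_polyLp (hℓ n) _
  simp only [h2]
  refine Finset.sum_subset (Finset.range_mono hM) fun n _ hn => ?_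
  refine Finset.sum_eq_zero fun v _ => ?_
  rw [hN n (by simpa using hn), map_zero, polyEnergy_zero]

/-- The differential expression `-P'' - z P`. -/
def shiftedNegSecondDeriv (z : ℂ) : ℂ[X] →ₗ[ℂ] ℂ[X] := negSecondDeriv - z • LinearMap.id

theorem polyTree_shifted (z : ℂ) (Φ : polyCore b ℓ q) :
    polyTree negSecondDeriv Φ - z • polyTree LinearMap.id Φ
      = polyTree (shiftedNegSecondDeriv z) Φ := by
  ext1
  funext e
  change polyLp _ (negSecondDeriv (Φ.1 e)) - z • polyLp _ (Φ.1 e)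
    = polyLp _ (negSecondDeriv (Φ.1 e) - z • Φ.1 e)
  rw [map_sub, map_smul]

/-- As a finite sum of integrals of polynomials, the property can be compared between different
trees, whose `L²` spaces differ. -/
theorem isApproxEigenvalue_iff (hℓ : ∀ n, 0 ≤ ℓ n) {z : ℂ} {ε : ℝ} (hε : 0 < ε) :
    IsApproxEigenvalue b ℓ q z ε ↔ ∃ Φ ∈ polyCore b ℓ q, ∃ N,
      (∀ n, N ≤ n → ∀ v, Φ ⟨n, v⟩ = 0) ∧
      ∑ n ∈ Finset.range N, ∑ v : TreeVertex b (n + 1),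
        polyEnergy (ℓ n) (shiftedNegSecondDeriv z (Φ ⟨n, v⟩))
      < ε ^ 2 * ∑ n ∈ Finset.range N, ∑ v : TreeVertex b (n + 1), polyEnergy (ℓ n) (Φ ⟨n, v⟩) := by
  have key : ∀ (Φ : polyCore b ℓ q) (N : ℕ), (∀ n, N ≤ n → ∀ v, Φ.1 ⟨n, v⟩ = 0) →
      (‖polyTree negSecondDeriv Φ - z • polyTree LinearMap.id Φ‖ < ε * ‖polyTree LinearMap.id Φ‖ ↔
      ∑ n ∈ Finset.range N, ∑ v : TreeVertex b (n + 1),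
        polyEnergy (ℓ n) (shiftedNegSecondDeriv z (Φ.1 ⟨n, v⟩))
      < ε ^ 2 * ∑ n ∈ Finset.range N, ∑ v : TreeVertex b (n + 1),
        polyEnergy (ℓ n) (Φ.1 ⟨n, v⟩)) := by
    intro Φ N hN
    have h1 := norm_sq_polyTree hℓ (shiftedNegSecondDeriv z) Φ hN
    have h2 := norm_sq_polyTree hℓ LinearMap.id Φ hN
    simp only [LinearMap.id_apply] at h2
    rw [← h1, ← h2, polyTree_shifted, ← mul_pow]
    exact (pow_lt_pow_iff_left₀ (norm_nonneg _) (by positivity) two_ne_zero).symm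
  constructor
  · rintro ⟨Φ, h⟩
    obtain ⟨N, hN⟩ := Φ.2.1
    exact ⟨Φ.1, Φ.2, N, hN, (key Φ N hN).mp h⟩
  · rintro ⟨Φ, hΦ, N, hN, h⟩
    exact ⟨⟨Φ, hΦ⟩, (key ⟨Φ, hΦ⟩ N hN).mpr h⟩

/-! ### Embedding of a subtree -/

/-- The position of a vertex of generation at least two in the subtree of its ancestor of
generation two, regarded as a radial tree with shifted parameters. -/
def TreeVertex.lower {b : ℕ → ℕ} : ∀ n, TreeVertex b (n + 2) → TreeVertex (fun m => b (m + 1)) (n + 1)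
  | 0, _ => ((), (0 : Fin 1))
  | n + 1, w => (TreeVertex.lower n w.1, w.2)

/-- The values `1`, `-1`, `0` on the descendants of the first, the second and the other children of
the vertex of generation one. -/
def TreeVertex.branchSign {b : ℕ → ℕ} : ∀ n, TreeVertex b (n + 2) → ℂ
  | 0, w => if w.2.val = 0 then 1 else if w.2.val = 1 then -1 else 0
  | n + 1, w => TreeVertex.branchSign n w.1

theorem sum_fin_branchSign {m : ℕ} (hm : 2 ≤ m) {E : Type*} [AddCommMonoid E] (g : ℂ → E)
    (hg : g 0 = 0) :
    ∑ j : Fin m, g (if j.val = 0 then 1 else if j.val = 1 then -1 else 0) = g 1 + g (-1) := by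
  obtain ⟨k, rfl⟩ := Nat.exists_eq_add_of_le' hm
  rw [Fin.sum_univ_succ, Fin.sum_univ_succ, Finset.sum_eq_zero]
  · simp
  · intro j _
    simp [hg]

/-- Exactly two of the subtrees carry a nonzero sign, and `lower` identifies each of them with the
shifted tree. -/
theorem TreeVertex.sum_branchSign (hb : 2 ≤ b 0) : ∀ (n : ℕ)
    (F : TreeVertex (fun m => b (m + 1)) (n + 1) → ℝ),
    ∑ w : TreeVertex b (n + 2), ‖w.branchSign n‖ ^ 2 * F (w.lower n) = 2 * ∑ v, F v := by
  intro n
  induction n with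
  | zero =>
    intro F
    have h1 := sum_fin_branchSign hb
      (fun c : ℂ => ‖c‖ ^ 2 * F ((), (0 : Fin 1))) (by simp)
    have h2 : ∑ v, F v = F ((), (0 : Fin 1)) := by
      rw [TreeVertex.sum_succ]
      exact (Fintype.sum_unique (ι := Unit) _).trans (Fintype.sum_unique (ι := Fin 1) _)
    rw [TreeVertex.sum_succ, TreeVertex.sum_succ, h2]
    refine (Fintype.sum_unique (ι := Unit) _).trans ((Fintype.sum_unique (ι := Fin 1) _).trans ?_)
    refine Eq.trans h1 ?_
    simp
    ring
  | succ n ih =>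
    intro F
    rw [TreeVertex.sum_succ F, ← ih fun v => ∑ j, F (v.child j)]
    refine (TreeVertex.sum_succ _).trans (Finset.sum_congr rfl fun w _ => ?_)
    rw [Finset.mul_sum]
    rfl

/-- Copies of a function, with opposite signs, on the first two subtrees of the vertex of
generation one. -/
def antisymmetricExtension {b : ℕ → ℕ} (Φ : TreeEdge (fun m => b (m + 1)) → ℂ[X]) :
    TreeEdge b → ℂ[X]
  | ⟨0, _⟩ => 0
  | ⟨n + 1, w⟩ => w.branchSign n • Φ ⟨n, w.lower n⟩

/-- At the vertex of generation one the Dirichlet condition of the shifted tree gives continuity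
with zero and removes the coupling term, while the opposite signs cancel the derivatives. Elsewhere
the conditions are inherited by linearity. -/
theorem antisymmetricExtension_mem_polyCore (hb : 2 ≤ b 0)
    {Φ : TreeEdge (fun m => b (m + 1)) → ℂ[X]}
    (hΦ : Φ ∈ polyCore (fun m => b (m + 1)) (fun m => ℓ (m + 1)) (fun m => q (m + 1))) :
    antisymmetricExtension Φ ∈ polyCore b ℓ q := by
  obtain ⟨⟨N, hN⟩, hd, hc, hk⟩ := hΦ
  refine ⟨⟨N + 1, fun n hn v => ?_⟩, ⟨fun v => ?_, fun n v j => ?_, fun n v => ?_⟩⟩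
  · obtain ⟨m, rfl⟩ := Nat.exists_eq_succ_of_ne_zero (show n ≠ 0 by omega)
    simp only [antisymmetricExtension]
    rw [hN m (by omega), smul_zero]
  · simp [antisymmetricExtension]
  · cases n with
    | zero =>
      simp only [antisymmetricExtension, eval_smul, eval_zero]
      rw [hd, smul_zero]
    | succ n =>
      simp only [antisymmetricExtension, eval_smul]
      exact congrArg _ (hc n (v.lower n) j)
  · cases n with
    | zero =>
      simp only [antisymmetricExtension, derivative_smul, eval_smul, smul_eq_mul, derivative_zero,
        eval_zero, sub_zero, mul_zero]
      have h1 := sum_fin_branchSign hb (fun c : ℂ =>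
        c * (derivative (Φ ⟨0, ((), (0 : Fin 1))⟩)).eval ((0 : ℝ) : ℂ)) (zero_mul _)
      refine Eq.trans h1 ?_
      ring
    | succ n =>
      have h1 := hk n (v.lower n)
      simp only [antisymmetricExtension, derivative_smul, eval_smul, smul_eq_mul]
      rw [mul_left_comm, ← h1, mul_sub, Finset.mul_sum]
      rfl

/-- Antisymmetric extension doubles both sides of the inequality. -/
theorem IsApproxEigenvalue.of_shift (hℓ : ∀ n, 0 ≤ ℓ n) (hb : 2 ≤ b 0) {z : ℂ} {ε : ℝ} (hε : 0 < ε)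
    (h : IsApproxEigenvalue (fun m => b (m + 1)) (fun m => ℓ (m + 1)) (fun m => q (m + 1)) z ε) :
    IsApproxEigenvalue b ℓ q z ε := by
  obtain ⟨Φ, hΦ, N, hN, hlt⟩ := (isApproxEigenvalue_iff (fun n => hℓ (n + 1)) hε).mp h
  refine (isApproxEigenvalue_iff hℓ hε).mpr ⟨_, antisymmetricExtension_mem_polyCore hb hΦ, N + 1,
    fun n hn v => ?_, ?_⟩
  · obtain ⟨m, rfl⟩ := Nat.exists_eq_succ_of_ne_zero (show n ≠ 0 by omega)
    simp only [antisymmetricExtension]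
    rw [hN m (by omega), smul_zero]
  · have key : ∀ D : ℂ[X] →ₗ[ℂ] ℂ[X], ∑ n ∈ Finset.range (N + 1), ∑ v : TreeVertex b (n + 1),
        polyEnergy (ℓ n) (D (antisymmetricExtension Φ ⟨n, v⟩))
        = 2 * ∑ n ∈ Finset.range N, ∑ v : TreeVertex (fun m => b (m + 1)) (n + 1),
          polyEnergy (ℓ (n + 1)) (D (Φ ⟨n, v⟩)) := by
      intro D
      rw [Finset.sum_range_succ', Finset.sum_eq_zero (s := Finset.univ), add_zero, Finset.mul_sum]
      · refine Finset.sum_congr rfl fun n _ => ?_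
        rw [← TreeVertex.sum_branchSign hb n
          fun v => polyEnergy (ℓ (n + 1)) (D (Φ ⟨n, v⟩))]
        refine Finset.sum_congr rfl fun v _ => ?_
        simp only [antisymmetricExtension]
        rw [map_smul, polyEnergy_smul]
      · intro v _
        simp only [antisymmetricExtension]
        rw [map_zero, polyEnergy_zero]
    have k2 := key LinearMap.id
    simp only [LinearMap.id_apply] at k2
    rw [key, k2]
    linarith

/-! ### Perturbation of the parameters -/

/-- The map between the vertices of two radial trees that preserves the numbering of the children
as far as possible. -/
def TreeVertex.transfer (b' : ℕ → ℕ) {b : ℕ → ℕ} (hb : ∀ n, 0 < branching b' n) :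
    ∀ n, TreeVertex b n → TreeVertex b' n
  | 0, _ => ()
  | n + 1, w => (TreeVertex.transfer b' hb n w.1, ⟨w.2.val % branching b' n, Nat.mod_lt _ (hb n)⟩)

theorem sum_fin_mod {m k : ℕ} (hm : 0 < m) (hmk : m = k) {E : Type*} [AddCommMonoid E]
    (g : Fin m → E) : ∑ j : Fin k, g ⟨j.val % m, Nat.mod_lt _ hm⟩ = ∑ j, g j := by
  subst hmk
  refine Finset.sum_congr rfl fun j _ => congrArg g (Fin.ext ?_)
  exact Nat.mod_eq_of_lt j.2

/-- Where the branching numbers agree, the reduction modulo the number of children does nothing, so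
`transfer` is a bijection on these generations. -/
theorem TreeVertex.sum_transfer (hb : ∀ n, 0 < branching b' n) {E : Type*} [AddCommMonoid E] :
    ∀ (n : ℕ), (∀ m < n, branching b' m = branching b m) → ∀ F : TreeVertex b' n → E,
    ∑ w : TreeVertex b n, F (w.transfer b' hb n) = ∑ v, F v := by
  intro n
  induction n with
  | zero => exact fun _ F => rfl
  | succ n ih =>
    intro h F
    rw [TreeVertex.sum_succ, TreeVertex.sum_succ,
      ← ih (fun m hm => h m (hm.trans n.lt_succ_self)) fun v => ∑ j, F (v.child j)]
    exact Finset.sum_congr rfl fun w _ => sum_fin_mod (hb n) (h n n.lt_succ_self)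
      fun j => F ((w.transfer b' hb n).child j)

/-- A perturbation of `P` that has on an edge of length `L` and a vertex with coupling constant `κ`
the same boundary behaviour as `P` on an edge of length `L₀` and a vertex with coupling constant
`κ₀`. -/
def boundaryCorrection (L₀ κ₀ L κ : ℝ) (P : ℂ[X]) : ℂ[X] :=
  P + hermiteCubic L 0 0 (P.eval (L₀ : ℂ) - P.eval (L : ℂ))
    ((derivative P).eval (L₀ : ℂ) + (κ₀ - κ) * P.eval (L₀ : ℂ) - (derivative P).eval (L : ℂ))

theorem boundaryCorrection_self (L κ : ℝ) (P : ℂ[X]) : boundaryCorrection L κ L κ P = P := by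
  simp [boundaryCorrection, hermiteCubic_zero]

theorem boundaryCorrection_zero (L₀ κ₀ L κ : ℝ) : boundaryCorrection L₀ κ₀ L κ 0 = 0 := by
  simp [boundaryCorrection, hermiteCubic_zero]

theorem eval_zero_boundaryCorrection (L₀ κ₀ L κ : ℝ) (P : ℂ[X]) :
    (boundaryCorrection L₀ κ₀ L κ P).eval ((0 : ℝ) : ℂ) = P.eval ((0 : ℝ) : ℂ) := by
  simp [boundaryCorrection, eval_hermiteCubic_left]

theorem eval_zero_derivative_boundaryCorrection (L₀ κ₀ L κ : ℝ) (P : ℂ[X]) :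
    (derivative (boundaryCorrection L₀ κ₀ L κ P)).eval ((0 : ℝ) : ℂ)
      = (derivative P).eval ((0 : ℝ) : ℂ) := by
  simp [boundaryCorrection, eval_derivative_hermiteCubic_left]

theorem eval_boundaryCorrection {L₀ κ₀ L κ : ℝ} (hL : L ≠ 0) (P : ℂ[X]) :
    (boundaryCorrection L₀ κ₀ L κ P).eval (L : ℂ) = P.eval (L₀ : ℂ) := by
  simp [boundaryCorrection, eval_hermiteCubic_right hL]

/-- The extra term compensates for the changed coupling: the outgoing derivatives minus it equal `κ
P(L₀)` precisely when the original ones satisfy the condition with `κ₀`. -/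
theorem eval_derivative_boundaryCorrection {L₀ κ₀ L κ : ℝ} (hL : L ≠ 0) (P : ℂ[X]) :
    (derivative (boundaryCorrection L₀ κ₀ L κ P)).eval (L : ℂ)
      = (derivative P).eval (L₀ : ℂ) + (κ₀ - κ) * P.eval (L₀ : ℂ) := by
  simp [boundaryCorrection, eval_derivative_hermiteCubic_right hL]

theorem continuous_polyEnergy_boundaryCorrection {Y : Type*} [TopologicalSpace Y] {L κ : Y → ℝ}
    (hL : Continuous L) (hκ : Continuous κ) (hL0 : ∀ y, L y ≠ 0) (L₀ κ₀ : ℝ) (P : ℂ[X]) :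
    Continuous fun y => polyEnergy (L y) (boundaryCorrection L₀ κ₀ (L y) (κ y) P) := by
  have hL1 : ∀ x : Y × ℝ, (L x.1 : ℂ) ≠ 0 := fun x => by exact_mod_cast hL0 x.1
  refine intervalIntegral.continuous_parametric_intervalIntegral_of_continuous ?_ hL
  have h1 : ∀ Q : ℂ[X], Continuous fun z : ℂ => Q.eval z := fun Q => Q.continuous
  simp only [boundaryCorrection, eval_add, eval_hermiteCubic, Function.uncurry_def]
  have hPL : Continuous fun y => P.eval (L y : ℂ) := (h1 P).comp (by fun_prop)
  have hP'L : Continuous fun y => (derivative P).eval (L y : ℂ) := (h1 _).comp (by fun_prop)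
  fun_prop (disch := exact hL1)

theorem continuous_polyEnergy_shifted_boundaryCorrection {Y : Type*} [TopologicalSpace Y]
    {L κ : Y → ℝ} (hL : Continuous L) (hκ : Continuous κ) (hL0 : ∀ y, L y ≠ 0) (L₀ κ₀ : ℝ)
    (z : ℂ) (P : ℂ[X]) : Continuous fun y =>
      polyEnergy (L y) (shiftedNegSecondDeriv z (boundaryCorrection L₀ κ₀ (L y) (κ y) P)) := by
  have hL1 : ∀ x : Y × ℝ, (L x.1 : ℂ) ≠ 0 := fun x => by exact_mod_cast hL0 x.1
  refine intervalIntegral.continuous_parametric_intervalIntegral_of_continuous ?_ hL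
  have h1 : ∀ Q : ℂ[X], Continuous fun z : ℂ => Q.eval z := fun Q => Q.continuous
  have h2 : ∀ (Q : ℂ[X]) (x : ℂ), (shiftedNegSecondDeriv z Q).eval x
      = -(derivative (derivative Q)).eval x - z * Q.eval x := by
    intro Q x
    simp [shiftedNegSecondDeriv, negSecondDeriv_apply]
  simp only [h2, boundaryCorrection, derivative_add, derivative_derivative_hermiteCubic, eval_add,
    eval_hermiteCubic, eval_mul, eval_C, eval_X, Function.uncurry_def]
  have hPL : Continuous fun y => P.eval (L y : ℂ) := (h1 P).comp (by fun_prop)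
  have hP'L : Continuous fun y => (derivative P).eval (L y : ℂ) := (h1 _).comp (by fun_prop)
  fun_prop (disch := exact hL1)

/-- The correction keeps the data at the near ends and adjusts those at the far ends to the new
length and coupling. Branching numbers matter only where `Φ` may be nonzero. -/
theorem transfer_mem_polyCore {ℓ' q' : ℕ → ℝ} (hb : ∀ n, 0 < branching b' n)
    (hℓ : ∀ n, ℓ n ≠ 0) {Φ : TreeEdge b' → ℂ[X]} (hΦ : Φ ∈ polyCore b' ℓ' q') {N : ℕ}
    (hN : ∀ n, N ≤ n → ∀ v, Φ ⟨n, v⟩ = 0) (hbb : ∀ n < N, b' n = b n) :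
    (fun e : TreeEdge b => boundaryCorrection (ℓ' e.1) (q' e.1) (ℓ e.1) (q e.1)
      (Φ ⟨e.1, e.2.transfer b' hb (e.1 + 1)⟩)) ∈ polyCore b ℓ q := by
  obtain ⟨-, hd, hc, hk⟩ := hΦ
  refine ⟨⟨N, fun n hn v => ?_⟩, ⟨fun v => ?_, fun n v j => ?_, fun n v => ?_⟩⟩
  · simp only [hN n hn, boundaryCorrection_zero]
  · rw [eval_zero_boundaryCorrection]
    exact hd _
  · rw [eval_zero_boundaryCorrection, eval_boundaryCorrection (hℓ n)]
    exact hc n _ _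
  · simp only [eval_zero_derivative_boundaryCorrection]
    rw [eval_derivative_boundaryCorrection (hℓ n), eval_boundaryCorrection (hℓ n)]
    have h1 := hk n (v.transfer b' hb (n + 1))
    have h2 : ∑ j : Fin (branching b (n + 1)), (derivative (Φ ⟨n + 1,
        (v.child j).transfer b' hb (n + 2)⟩)).eval ((0 : ℝ) : ℂ)
        = ∑ j, (derivative (Φ ⟨n + 1, (v.transfer b' hb (n + 1)).child j⟩)).eval
          ((0 : ℝ) : ℂ) := by
      rcases lt_or_ge n N with hn | hn
      · exact sum_fin_mod (hb (n + 1)) (hbb n hn) fun j =>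
          (derivative (Φ ⟨n + 1, (v.transfer b' hb (n + 1)).child j⟩)).eval ((0 : ℝ) : ℂ)
      · rw [Finset.sum_eq_zero, Finset.sum_eq_zero] <;>
        · intro j _
          rw [hN (n + 1) (by omega), derivative_zero, eval_zero]
    rw [h2]
    linear_combination h1

end Tree

/-! ### Stability of approximate eigenvalues under perturbation of the parameters -/

section Params

open Polynomial Filter Topology

variable {bmin bmax : ℕ} {lmin lmax qmin qmax : ℝ}

/-- Being an approximate eigenvalue is an open condition on the parameters. -/
theorem isOpen_isApproxEigenvalue (hb : 0 < bmin) (hl : 0 < lmin) (z : ℂ) {ε : ℝ} (hε : 0 < ε) :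
    IsOpen {ω : ℕ → paramSet bmin bmax lmin lmax qmin qmax |
      IsApproxEigenvalue (fun n => (ω n).1.1) (fun n => (ω n).1.2.1) (fun n => (ω n).1.2.2) z ε} := by
  have hpos : ∀ y : paramSet bmin bmax lmin lmax qmin qmax, 0 < y.1.2.1 := fun y =>
    hl.trans_le y.2.2.1.1
  have hbr : ∀ (ω : ℕ → paramSet bmin bmax lmin lmax qmin qmax) n,
      0 < branching (fun n => (ω n).1.1) n := by
    rintro ω (_ | n)
    · exact one_pos
    · exact hb.trans_le (ω n).2.1.1
  rw [isOpen_iff_mem_nhds]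
  intro p hp
  obtain ⟨Φ, hΦ, N, hN, hlt⟩ := (isApproxEigenvalue_iff (fun n => (hpos (p n)).le) hε).mp hp
  -- The sum runs over the fixed tree of `p`; only lengths and couplings vary, and at `ω = p` the
  -- correction is trivial.
  have hcont1 : Continuous fun ω : ℕ → paramSet bmin bmax lmin lmax qmin qmax =>
      ∑ n ∈ Finset.range N, ∑ v : TreeVertex (fun n => (p n).1.1) (n + 1),
        polyEnergy ((ω n).1.2.1) (shiftedNegSecondDeriv z (boundaryCorrection (p n).1.2.1
          (p n).1.2.2 (ω n).1.2.1 (ω n).1.2.2 (Φ ⟨n, v⟩))) :=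
    continuous_finsetSum _ fun n _ => continuous_finsetSum _ fun v _ =>
      continuous_polyEnergy_shifted_boundaryCorrection (by fun_prop) (by fun_prop)
        (fun ω => (hpos _).ne') _ _ _ _
  have hcont2 : Continuous fun ω : ℕ → paramSet bmin bmax lmin lmax qmin qmax =>
      ε ^ 2 * ∑ n ∈ Finset.range N, ∑ v : TreeVertex (fun n => (p n).1.1) (n + 1),
        polyEnergy ((ω n).1.2.1) (boundaryCorrection (p n).1.2.1
          (p n).1.2.2 (ω n).1.2.1 (ω n).1.2.2 (Φ ⟨n, v⟩)) :=
    continuous_const.mul (continuous_finsetSum _ fun n _ => continuous_finsetSum _ fun v _ =>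
      continuous_polyEnergy_boundaryCorrection (by fun_prop) (by fun_prop)
        (fun ω => (hpos _).ne') _ _ _)
  have hev1 : ∀ᶠ ω in 𝓝 p, ∑ n ∈ Finset.range N, ∑ v : TreeVertex (fun n => (p n).1.1) (n + 1),
        polyEnergy ((ω n).1.2.1) (shiftedNegSecondDeriv z (boundaryCorrection (p n).1.2.1
          (p n).1.2.2 (ω n).1.2.1 (ω n).1.2.2 (Φ ⟨n, v⟩)))
      < ε ^ 2 * ∑ n ∈ Finset.range N, ∑ v : TreeVertex (fun n => (p n).1.1) (n + 1),
        polyEnergy ((ω n).1.2.1) (boundaryCorrection (p n).1.2.1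
          (p n).1.2.2 (ω n).1.2.1 (ω n).1.2.2 (Φ ⟨n, v⟩)) := by
    refine hcont1.continuousAt.eventually_lt hcont2.continuousAt ?_
    simpa only [boundaryCorrection_self] using hlt
  -- Branching numbers are discrete, so the first `N` of them are locally constant.
  have hev2 : ∀ᶠ ω in 𝓝 p, ∀ n ∈ Finset.range N, (p n).1.1 = (ω n).1.1 := by
    rw [eventually_all_finset]
    intro n _
    have hc : Continuous fun ω : ℕ → paramSet bmin bmax lmin lmax qmin qmax => (ω n).1.1 := by
      fun_prop
    have := hc.continuousAt (x := p) (isOpen_discrete {(p n).1.1} |>.mem_nhds rfl)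
    filter_upwards [this] with ω hω using hω.symm
  filter_upwards [hev1, hev2] with ω h1 h2
  have hbb : ∀ n < N, (p n).1.1 = (ω n).1.1 := fun n hn => h2 n (Finset.mem_range.mpr hn)
  refine (isApproxEigenvalue_iff (fun n => (hpos (ω n)).le) hε).mpr
    ⟨_, transfer_mem_polyCore (hbr p) (fun n => (hpos _).ne') hΦ hN hbb, N, fun n hn v => ?_, ?_⟩
  · simp only [hN n hn, boundaryCorrection_zero]
  · have hsum : ∀ n ∈ Finset.range N, ∀ F : TreeVertex (fun n => (p n).1.1) (n + 1) → ℝ,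
        ∑ w : TreeVertex (fun n => (ω n).1.1) (n + 1), F (w.transfer _ (hbr p) (n + 1))
        = ∑ v, F v := by
      intro n hn F
      refine TreeVertex.sum_transfer (hbr p) (n + 1) (fun m hm => ?_) F
      cases m with
      | zero => rfl
      | succ m => exact hbb m (by rw [Finset.mem_range] at hn; omega)
    have e1 := Finset.sum_congr rfl fun n hn => hsum n hn fun v =>
      polyEnergy ((ω n).1.2.1) (shiftedNegSecondDeriv z (boundaryCorrection (p n).1.2.1
          (p n).1.2.2 (ω n).1.2.1 (ω n).1.2.2 (Φ ⟨n, v⟩)))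
    have e2 := Finset.sum_congr rfl fun n hn => hsum n hn fun v =>
      polyEnergy ((ω n).1.2.1) (boundaryCorrection (p n).1.2.1
          (p n).1.2.2 (ω n).1.2.1 (ω n).1.2.2 (Φ ⟨n, v⟩))
    rw [← e1, ← e2] at h1
    exact h1

end Params

/-! ### Recurrence of patterns -/

section Recurrence

open Filter Topology

variable {X : Type*} [TopologicalSpace X] [MeasurableSpace X] (ν : Measure X)
  [IsProbabilityMeasure ν]

/-- Shrink `U` to a cylinder around `p` over the first `M` coordinates. The events that disjoint
blocks of length `M` match it are independent, with equal probability, positive because each `p n`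
is in the support; the second Borel–Cantelli lemma applies. -/
theorem ae_exists_shift_mem [OpensMeasurableSpace X] {U : Set (ℕ → X)} (hU : IsOpen U) {p : ℕ → X} (hp : p ∈ U)
    (hsupp : ∀ n, p n ∈ ν.support) :
    ∀ᵐ ω ∂(Measure.infinitePi fun _ : ℕ => ν), ∃ k, (fun n => ω (n + k)) ∈ U := by
  classical
  obtain ⟨I, u, hu, hsub⟩ := isOpen_pi_iff.mp hU p hp
  obtain ⟨M, hM⟩ : ∃ M, ∀ i ∈ I, i < M :=
    ⟨I.sup id + 1, fun i hi => Nat.lt_succ_of_le (Finset.le_sup (f := id) hi)⟩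
  set v : ℕ → Set X := fun i => if i ∈ I then u i else univ with hv
  have hvo : ∀ i, IsOpen (v i) := fun i => by
    simp only [hv]
    split_ifs with hi
    · exact (hu i hi).1
    · exact isOpen_univ
  have hvp : ∀ i, p i ∈ v i := fun i => by
    simp only [hv]
    split_ifs with hi
    · exact (hu i hi).2
    · trivial
  -- `J k` is the `k`-th block, and `A k` the event that `ω` matches the pattern `v` on it; `j % M`
  -- is the position of `j` in its block.
  set J : ℕ → Finset ℕ := fun k => Finset.Ico (M * k) (M * k + M) with hJ
  set A : ℕ → Set (ℕ → X) := fun k => Set.pi (J k) fun j => v (j % M) with hA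
  have hmeas : ∀ j, MeasurableSet (v (j % M)) := fun j => (hvo _).measurableSet
  have hAm : ∀ k, MeasurableSet (A k) := fun k =>
    MeasurableSet.pi (J k).countable_toSet fun j _ => hmeas j
  have hμ : ∀ s : Finset ℕ, Measure.infinitePi (fun _ : ℕ => ν) (Set.pi s fun j => v (j % M))
      = ∏ j ∈ s, ν (v (j % M)) := fun s => Measure.infinitePi_pi _ fun j _ => hmeas j
  have hdisj : Pairwise fun k l => Disjoint (J k) (J l) := by
    intro k l hkl
    wlog h : k < l generalizing k l
    · exact (this hkl.symm (lt_of_le_of_ne (not_lt.mp h) hkl.symm)).symm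
    rw [Finset.disjoint_left]
    intro j hj hj'
    rw [hJ, Finset.mem_Ico] at hj hj'
    have : M * (k + 1) ≤ M * l := Nat.mul_le_mul_left _ h
    rw [mul_add, mul_one] at this
    omega
  have hind : ProbabilityTheory.iIndepSet A (Measure.infinitePi fun _ : ℕ => ν) := by
    rw [ProbabilityTheory.iIndepSet_iff_meas_biInter hAm]
    intro s
    have h1 : ⋂ k ∈ s, A k = Set.pi (s.biUnion J : Finset ℕ) fun j => v (j % M) := by
      ext ω
      simp only [hA, mem_iInter, Set.mem_pi, Finset.mem_coe, Finset.mem_biUnion]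
      exact ⟨fun h j ⟨k, hk, hj⟩ => h k hk j hj, fun h k hk j hj => h j ⟨k, hk, hj⟩⟩
    rw [h1, hμ, Finset.prod_biUnion fun k _ l _ hkl => hdisj hkl]
    exact Finset.prod_congr rfl fun k _ => (hμ (J k)).symm
  have hconst : ∀ k, Measure.infinitePi (fun _ : ℕ => ν) (A k)
      = ∏ i ∈ Finset.range M, ν (v i) := by
    intro k
    rw [hA, hμ, hJ, Finset.prod_Ico_eq_prod_range, Nat.add_sub_cancel_left]
    refine Finset.prod_congr rfl fun i hi => ?_
    rw [Nat.mul_add_mod, Nat.mod_eq_of_lt (Finset.mem_range.mp hi)]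
  have hpos : ∏ i ∈ Finset.range M, ν (v i) ≠ 0 := Finset.prod_ne_zero_iff.mpr fun i _ =>
    ((Measure.mem_support_iff_forall (μ := ν) _).mp (hsupp i) _ ((hvo i).mem_nhds (hvp i))).ne'
  have hlim := ProbabilityTheory.measure_limsup_eq_one hAm hind
    (by simp only [hconst]; exact ENNReal.tsum_const_eq_top_of_ne_zero hpos)
  have hlm : MeasurableSet (limsup A atTop) := MeasurableSet.measurableSet_limsup hAm
  filter_upwards [(mem_ae_iff_prob_eq_one hlm).mpr hlim] with ω hω
  rw [mem_limsup_iff_frequently_mem] at hω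
  obtain ⟨k, hk⟩ := hω.exists
  refine ⟨M * k, hsub fun i hi => ?_⟩
  have hiM := hM i hi
  have h2 := hk (i + M * k) (by simp only [hJ, Finset.coe_Ico, Set.mem_Ico]; omega)
  simp only [Nat.add_mul_mod_self_left, Nat.mod_eq_of_lt hiM, hv] at h2
  rwa [if_pos (Finset.mem_coe.mp hi)] at h2

/-- A countable basis of the sequence space gives one null set for all open sets and all `p`. -/
theorem ae_forall_isOpen_exists_shift_mem [OpensMeasurableSpace X] [SecondCountableTopology X] :
    ∀ᵐ ω ∂(Measure.infinitePi fun _ : ℕ => ν), ∀ U : Set (ℕ → X), IsOpen U → ∀ p ∈ U,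
      (∀ n, p n ∈ ν.support) → ∃ k, (fun n => ω (n + k)) ∈ U := by
  have hB := TopologicalSpace.isBasis_countableBasis (ℕ → X)
  have h1 : ∀ᵐ ω ∂(Measure.infinitePi fun _ : ℕ => ν),
      ∀ U ∈ TopologicalSpace.countableBasis (ℕ → X), ∀ p ∈ U,
      (∀ n, p n ∈ ν.support) → ∃ k, (fun n => ω (n + k)) ∈ U := by
    rw [ae_ball_iff (TopologicalSpace.countable_countableBasis _)]
    intro U hU
    by_cases h : ∃ p ∈ U, ∀ n, p n ∈ ν.support
    · obtain ⟨p, hp, hs⟩ := h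
      filter_upwards [ae_exists_shift_mem ν (hB.isOpen hU) hp hs] with ω hω _ _ _ using hω
    · exact Eventually.of_forall fun ω p hp hs => absurd ⟨p, hp, hs⟩ h
  filter_upwards [h1] with ω hω U hU p hp hs
  obtain ⟨V, hV, hpV, hVU⟩ := hB.exists_subset_of_mem_open hp hU
  obtain ⟨k, hk⟩ := hω V hV p hpV hs
  exact ⟨k, hVU hk⟩

theorem ae_forall_mem_support [HereditarilyLindelofSpace X] :
    ∀ᵐ ω ∂(Measure.infinitePi fun _ : ℕ => ν), ∀ n, ω n ∈ ν.support := by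
  rw [ae_all_iff]
  intro n
  exact (measurePreserving_eval_infinitePi (fun _ : ℕ => ν) n).quasiMeasurePreserving.ae
    Measure.support_mem_ae

end Recurrence

/-! ### The almost sure spectrum -/

section Spectrum

open Filter Topology

variable {bmin bmax : ℕ} {lmin lmax qmin qmax : ℝ}

theorem boundedParams_of_paramSet (hl : 0 < lmin)
    (ω : ℕ → paramSet bmin bmax lmin lmax qmin qmax) :
    BoundedParams (fun n => (ω n).1.2.1) (fun n => (ω n).1.2.2) lmin lmax (|qmin| + |qmax|) where
  pos := hl
  length n := (ω n).2.2.1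
  coupling n := by
    obtain ⟨h1, h2⟩ := (ω n).2.2.2
    have h3 := neg_abs_le qmin
    have h4 := le_abs_self qmax
    have h5 := abs_nonneg qmin
    have h6 := abs_nonneg qmax
    exact abs_le.mpr ⟨by linarith, by linarith⟩

theorem IsApproxEigenvalue.of_iterate_shift (hb : 2 ≤ bmin) (hl : 0 < lmin) {z : ℂ} {ε : ℝ}
    (hε : 0 < ε) (k : ℕ) : ∀ ω : ℕ → paramSet bmin bmax lmin lmax qmin qmax,
    IsApproxEigenvalue (fun n => (ω (n + k)).1.1) (fun n => (ω (n + k)).1.2.1)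
      (fun n => (ω (n + k)).1.2.2) z ε →
    IsApproxEigenvalue (fun n => (ω n).1.1) (fun n => (ω n).1.2.1) (fun n => (ω n).1.2.2) z ε := by
  induction k with
  | zero => exact fun ω h => h
  | succ k ih =>
    intro ω h
    exact IsApproxEigenvalue.of_shift (fun n => ((boundedParams_of_paramSet hl ω).length_pos n).le)
      (hb.trans (ω 0).2.1.1) hε (ih (fun n => ω (n + 1)) h)

theorem exists_isSemiboundedCore_of_paramSet (hl : 0 < lmin)
    (ω : ℕ → paramSet bmin bmax lmin lmax qmin qmax) :
    ∃ c : ℝ, IsSemiboundedCore (treeLaplacian (fun n => (ω n).1.1) (fun n => (ω n).1.2.1)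
      (fun n => (ω n).1.2.2)) (polyTree (q := fun n => (ω n).1.2.2) LinearMap.id)
      (polyTree (q := fun n => (ω n).1.2.2) negSecondDeriv) c := by
  obtain ⟨c, hc⟩ := exists_isSemiboundedCore (lmax := lmax) (Q := |qmin| + |qmax|) hl
    (by positivity)
  exact ⟨c, hc (boundedParams_of_paramSet hl ω)⟩

theorem isClosed_treeSpectrum (hl : 0 < lmin) (ω : ℕ → paramSet bmin bmax lmin lmax qmin qmax) :
    IsClosed (treeSpectrum ω) := by
  obtain ⟨c, hc⟩ := exists_isSemiboundedCore_of_paramSet hl ω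
  exact hc.isClosed_unboundedSpectrum

theorem isApproxEigenvalue_of_mem_treeSpectrum (hl : 0 < lmin)
    {ω : ℕ → paramSet bmin bmax lmin lmax qmin qmax} {z : ℂ} (hz : z ∈ treeSpectrum ω) :
    z.im = 0 ∧ ∀ ε > 0, IsApproxEigenvalue (fun n => (ω n).1.1) (fun n => (ω n).1.2.1)
      (fun n => (ω n).1.2.2) z ε := by
  obtain ⟨c, hc⟩ := exists_isSemiboundedCore_of_paramSet hl ω
  exact ⟨hc.im_eq_zero_of_mem hz, fun ε hε => hc.exists_approx_eigenvector hz hε⟩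

theorem IsApproxEigenvalue.exists_mem_treeSpectrum (hl : 0 < lmin)
    {ω : ℕ → paramSet bmin bmax lmin lmax qmin qmax} {z : ℂ} (hz : z.im = 0) {ε : ℝ}
    (h : IsApproxEigenvalue (fun n => (ω n).1.1) (fun n => (ω n).1.2.1)
      (fun n => (ω n).1.2.2) z ε) : ∃ w ∈ treeSpectrum ω, ‖w - z‖ ≤ ε := by
  obtain ⟨c, hc⟩ := exists_isSemiboundedCore_of_paramSet hl ω
  obtain ⟨Φ, hΦ⟩ := h
  exact hc.exists_mem_spectrum_of_approx hz hΦ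

/-- Periodizations of initial segments of `ω` converge to `ω`, so by openness they inherit its
approximate eigenvalues. -/
theorem treeSpectrum_subset_periodicSpectrum (hb : 2 ≤ bmin) (hl : 0 < lmin)
    (ν : Measure (paramSet bmin bmax lmin lmax qmin qmax))
    {ω : ℕ → paramSet bmin bmax lmin lmax qmin qmax} (hω : ∀ n, ω n ∈ ν.support) :
    treeSpectrum ω ⊆ periodicSpectrum ν := by
  intro z hz
  obtain ⟨him, happ⟩ := isApproxEigenvalue_of_mem_treeSpectrum hl hz
  refine Metric.mem_closure_iff.mpr fun ε hε => ?_
  have hopen := isOpen_isApproxEigenvalue (bmax := bmax) (lmax := lmax) (qmin := qmin)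
    (qmax := qmax) (by omega : 0 < bmin) hl z (half_pos hε)
  -- The periodization with period `M + 1` agrees with `ω` at every index up to `M`, which suffices
  -- in the product topology.
  have htend : Tendsto (fun M n => ω (n % (M + 1))) atTop (𝓝 ω) := by
    rw [tendsto_pi_nhds]
    intro n
    refine tendsto_const_nhds.congr' ?_
    filter_upwards [eventually_ge_atTop n] with M hM
    rw [Nat.mod_eq_of_lt (Nat.lt_succ_of_le hM)]
  obtain ⟨M, hM⟩ := (htend.eventually (hopen.mem_nhds (happ _ (half_pos hε)))).exists
  obtain ⟨w, hw, hwz⟩ := IsApproxEigenvalue.exists_mem_treeSpectrum hl him hM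
  refine ⟨w, mem_biUnion ⟨fun n => hω _, M + 1, M.succ_pos, fun n => ?_⟩ hw, ?_⟩
  · simp only [Nat.add_mod_right]
  · rw [dist_comm, dist_eq_norm]
    linarith

/-- The parameter sequences sharing an approximate eigenvalue with `p` form an open set containing
`p`; some shift of `ω` falls into it, and transplantation through the first `k` generations returns
to `ω`. -/
theorem periodicSpectrum_subset_treeSpectrum (hb : 2 ≤ bmin) (hl : 0 < lmin)
    (ν : Measure (paramSet bmin bmax lmin lmax qmin qmax))
    {ω : ℕ → paramSet bmin bmax lmin lmax qmin qmax}
    (hω : ∀ U : Set (ℕ → paramSet bmin bmax lmin lmax qmin qmax), IsOpen U → ∀ p ∈ U,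
      (∀ n, p n ∈ ν.support) → ∃ k, (fun n => ω (n + k)) ∈ U) :
    periodicSpectrum ν ⊆ treeSpectrum ω := by
  refine closure_minimal ?_ (isClosed_treeSpectrum hl ω)
  refine iUnion₂_subset fun p hp z hz => ?_
  obtain ⟨him, happ⟩ := isApproxEigenvalue_of_mem_treeSpectrum hl hz
  rw [← (isClosed_treeSpectrum hl ω).closure_eq]
  refine Metric.mem_closure_iff.mpr fun ε hε => ?_
  have hopen := isOpen_isApproxEigenvalue (bmax := bmax) (lmax := lmax) (qmin := qmin)
    (qmax := qmax) (by omega : 0 < bmin) hl z (half_pos hε)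
  obtain ⟨k, hk⟩ := hω _ hopen p (happ _ (half_pos hε)) hp.1
  obtain ⟨w, hw, hwz⟩ := IsApproxEigenvalue.exists_mem_treeSpectrum hl him
    (IsApproxEigenvalue.of_iterate_shift hb hl (half_pos hε) k ω hk)
  refine ⟨w, hw, ?_⟩
  rw [dist_comm, dist_eq_norm]
  linarith

end Spectrum

end

theorem theorem4p1 (bmin bmax : ℕ) (lmin lmax qmin qmax : ℝ) (hb : 2 ≤ bmin) (hl : 0 < lmin)
    (ν : Measure (paramSet bmin bmax lmin lmax qmin qmax)) [IsProbabilityMeasure ν] :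
    ∀ᵐ ω ∂(Measure.infinitePi fun _ : ℕ => ν), treeSpectrum ω = periodicSpectrum ν := by
  filter_upwards [ae_forall_mem_support ν, ae_forall_isOpen_exists_shift_mem ν] with ω h1 h2
  exact (treeSpectrum_subset_periodicSpectrum hb hl ν h1).antisymm
    (periodicSpectrum_subset_treeSpectrum hb hl ν h2)
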